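/- Let $n$ be a positive integer, $R$ a commutative ring and $\beta\in R$. Work with Laurent polynomials in $x_1,\dots,x_n$ over $R$, write $x^v=x_1^{v_1}\cdots x_n^{v_n}$ for $v\in\mathbb Z^n$, and let $CT$ denote the constant term. Let $s_i$ ($1\le i<n$) exchange the components $v_i,v_{i+1}$ of a vector, let $s_n$ change $v_n$ into $-v_n$, and let $\tau_n$ (for $n\ge 2$) change $[\dots,v_{n-1},v_n]$ into $[\dots,-v_n,-v_{n-1}]$; these operators act on Laurent polynomials through exponents, $f\mapsto f^{s_i}$, etc., and are written on the right. Define $$f\pi_i=\frac{x_if-x_{i+1}f^{s_i}}{x_i-x_{i+1}}\ (i<n),\quad f\pi_n^{B}=\frac{x_nf-f^{s_n}}{x_n-1},\quad f\pi_n^{C}=\frac{x_nf-x_n^{-1}f^{s_n}}{x_n-x_n^{-1}},$$ $$f\pi_n^{BC}=\frac{(x_n+\beta)f-(x_n^{-1}+\beta)f^{s_n}}{x_n-x_n^{-1}},\quad f\pi_n^{D}=\frac{f-x_{n-1}^{-1}x_n^{-1}f^{\tau_n}}{1-x_{n-1}^{-1}x_n^{-1}},$$ and $\hat\pi=\pi-1$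 for each of these operators. For $\heartsuit\in\{A,B,C,D,BC\}$ the key polynomials $K_v=K_v^\heartsuit$ and $\hat K_v=\hat K_v^\heartsuit$ are defined by $K_\lambda=\hat K_\lambda=x^\lambda$ for every partition $\lambda\in\mathbb N^n$ and by the recursions $K_{vs_i}=K_v\pi_i$, $\hat K_{vs_i}=\hat K_v\hat\pi_i$ if $i<n$ and $v_i>v_{i+1}$; for $\heartsuit=B,C,BC$ also $K_{vs_n}=K_v\pi_n^\heartsuit$, $\hat K_{vs_n}=\hat K_v\hat\pi_n^\heartsuit$ if $v_n>0$; for $\heartsuit=D$ (and $n\ge2$) also $K_{v\tau_n}=K_v\pi_n^D$, $\hat K_{v\tau_n}=\hat K_v\hat\pi_n^D$ if $\ell(v\tau_n)>\ell(v)$, where $\ell(v)$ is the least number of generators $s_1,\dots,s_{n-1},\tau_n$ leading from $v$ to the decreasing reordering of $|v_1|,\dots,|v_n|$. Thus $K_v,\hat K_v$ are defined for all $v\in\mathbb N^n$ in type $A$, for all $v\in\mathbb Z^n$ in types $B,C,BC$, and, in type $D$, for those $v\in\mathbb Z^n$ that have a zero component or an even number of negative components. Put $$\Delta^D=\prod_{i<j}(x_i-x_j)\Bigl(1-\frac1{x_ix_j}\Bigr),\quad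 \Delta^B=\Delta^D\prod_i(x_i^{1/2}-x_i^{-1/2}),\quad \Delta^C=\Delta^D\prod_i(x_i-x_i^{-1}),\quad \Delta^{BC}=\Delta^C\prod_i(1+\beta x_i)^{-1},$$ where $(1+\beta x_i)^{-1}$ is expanded as a formal series in $\beta x_i$, and $\rho^B=[n-\frac12,\dots,\frac32,\frac12]$, $\rho^C=\rho^{BC}=[n,\dots,2,1]$, $\rho^D=[n-1,\dots,1,0]$. For Laurent polynomials $f,g$ let $$(f,g)^\heartsuit=CT\bigl(f\,g\,x^{\rho^\heartsuit}\Delta^\heartsuit\bigr)\quad(\heartsuit=B,C,D,BC),$$ $$(f,g)^A=CT\Bigl(f(x_1,\dots,x_n)\,g(x_n^{-1},\dots,x_1^{-1})\prod_{i<j}(1-x_ix_j^{-1})\Bigr).$$ Then: 1. For $\heartsuit=B,C,BC$ and all $u,v\in\mathbb Z^n$, $(K_v,\hat K_u)^\heartsuit=(-1)^n\,\delta_{-v,u}$. 2. For $\heartsuit=D$ and all $u,v\in\mathbb Z^n$ for which $K_v^D$ and $\hat K_u^D$ are defined, such that moreover, if $n$ is odd, $u$ or $v$ has at least one component equal to $0$: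 $(K_v,\hat K_u)^D=\delta_{-v,u}$. 3. For type $A$ and all $u,v\in\mathbb N^n$, $(K_v,\hat K_u)^A=\delta_{v,u\omega}$, where $u\omega=[u_n,\dots,u_1]$. -/

import Mathlib

namespace KeyPoly

noncomputable section

/-- Laurent polynomials in `x_1, …, x_n` over `R`: finite `R`-combinations of the monomials
`x^v`, `v ∈ ℤ^n`. The variables are indexed by `Fin n`, so that the variable `x_k` of the usual
notation has the index `k - 1`. -/
abbrev Laurent (n : ℕ) (R : Type*) [CommRing R] := AddMonoidAlgebra R (Fin n → ℤ)

/-- The five types of kernels, key polynomials and scalar products. Type `BC` depends on a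
parameter `β`. -/
inductive KeyType (R : Type*)
  | A
  | B
  | C
  | D
  | BC (β : R)

section Laurent

variable {n : ℕ} {R : Type*} [CommRing R]

/-- The Laurent monomial `x^v`. -/
def mon (v : Fin n → ℤ) : Laurent n R := AddMonoidAlgebra.single v 1

/-- The variable `x_i`. -/
def x (i : Fin n) : Laurent n R := mon (Pi.single i 1)

/-- The inverse `x_i⁻¹` of the variable `x_i`. -/
def xInv (i : Fin n) : Laurent n R := mon (Pi.single i (-1))

/-- The Laurent polynomial that is constant, equal to `r`. -/
def const (r : R) : Laurent n R := AddMonoidAlgebra.single 0 r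

/-- The linear extension to Laurent polynomials of a map on exponents, `x^v ↦ x^(φ v)`. -/
def onMonomials (φ : (Fin n → ℤ) → (Fin n → ℤ)) (f : Laurent n R) : Laurent n R :=
  AddMonoidAlgebra.mapDomain φ f

open Classical in
/-- The exact quotient `a / d` of Laurent polynomials. It is only used where `d` divides `a`
and `d` is not a zero divisor. -/
def quot (a d : Laurent n R) : Laurent n R :=
  if h : ∃ q : Laurent n R, q * d = a then h.choose else 0

end Laurent

/-- The simple reflections of the classical groups: `s i j` (for consecutive indices `i`, `j`) is
the transposition of the components `i` and `j`; `neg i` (for `i` the last index) is the operator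
`s_n` that changes the sign of the last component; `tau i j` (for `i`, `j` the last two indices)
is the operator `τ_n`. -/
inductive Generator (n : ℕ)
  | s (i j : Fin n) (h : (i : ℕ) + 1 = j)
  | neg (i : Fin n) (h : (i : ℕ) + 1 = n)
  | tau (i j : Fin n) (hi : (i : ℕ) + 2 = n) (hj : (j : ℕ) + 1 = n)

/-- The action of the generators on vectors:
`[…, a, b, …] s_i = […, b, a, …]`, `[…, a] s_n = […, -a]`, `[…, a, b] τ_n = […, -b, -a]`. -/
def Generator.act {n : ℕ} : Generator n → (Fin n → ℤ) → (Fin n → ℤ)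
  | .s i j _, v => Function.update (Function.update v i (v j)) j (v i)
  | .neg i _, v => Function.update v i (-v i)
  | .tau i j _ _, v => Function.update (Function.update v i (-v j)) j (-v i)

/-- `w` is the decreasing reordering of `|v_1|, …, |v_n|`. -/
def IsDecreasingReordering {n : ℕ} (v w : Fin n → ℤ) : Prop :=
  Antitone w ∧ ∃ σ : Equiv.Perm (Fin n), ∀ i, w i = |v (σ i)|

section Key

variable {n : ℕ} {R : Type*} [CommRing R]

/-- The generators that belong to the Weyl group of each type. -/
def KeyType.Uses : KeyType R → Generator n → Prop
  | _, .s _ _ _ => True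
  | .B, .neg _ _ => True
  | .C, .neg _ _ => True
  | .BC _, .neg _ _ => True
  | .D, .tau _ _ _ _ => True
  | _, _ => False

/-- The length of a vector `v` for the group of the given type: the minimum number of generators
that must be applied to pass from `v` to the decreasing reordering of `|v_1|, …, |v_n|`. -/
def KeyType.length (t : KeyType R) (v : Fin n → ℤ) : ℕ :=
  sInf {k | ∃ l : List (Generator n), l.length = k ∧ (∀ g ∈ l, t.Uses g) ∧
    IsDecreasingReordering v (l.foldl (fun w g => g.act w) v)}

/-- The condition under which the recursion passes from the key polynomials of index `v` to those
of index `g.act v`: `v_i > v_{i+1}` for `s_i`, `v_n > 0` for `s_n`, and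
`ℓ(v τ_n) > ℓ(v)` (length of type `D`) for `τ_n`. -/
def KeyType.Ascends (t : KeyType R) (v : Fin n → ℤ) : Generator n → Prop
  | .s i j _ => v j < v i
  | .neg i _ => 0 < v i
  | .tau i j hi hj => t.length v < t.length ((Generator.tau i j hi hj).act v)

/-- The isobaric divided differences `f ↦ f π_i` (for all types), `f ↦ f π_n^♡` (for types
`B`, `C`, `BC`, `D`). For a generator that does not belong to the group of the given type the value
is irrelevant, and set to `0`. -/
def KeyType.pi (t : KeyType R) (g : Generator n) (f : Laurent n R) : Laurent n R :=
  match t, g with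
  | _, .s i j _ => quot (x i * f - x j * onMonomials g.act f) (x i - x j)
  | .B, .neg i _ => quot (x i * f - onMonomials g.act f) (x i - 1)
  | .C, .neg i _ => quot (x i * f - xInv i * onMonomials g.act f) (x i - xInv i)
  | .BC β, .neg i _ =>
      quot ((x i + const β) * f - (xInv i + const β) * onMonomials g.act f) (x i - xInv i)
  | .D, .tau i j _ _ =>
      quot (f - xInv i * xInv j * onMonomials g.act f) (1 - xInv i * xInv j)
  | _, _ => 0

/-- The second family of operators, `π̂ = π - 1`. -/
def KeyType.piHat (t : KeyType R) (g : Generator n) (f : Laurent n R) : Laurent n R :=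
  t.pi g f - f

/-- The recursive definition of the key polynomials for a family `op` of operators indexed by the
generators: `x^λ` has the index `λ` for every partition `λ ∈ ℕ^n`, and if `f` has the index `v` and
the condition for passing from `v` to `g.act v` holds, then the image of `f` under `op g` has the
index `g.act v`. -/
inductive IsKey (t : KeyType R) (op : Generator n → Laurent n R → Laurent n R) :
    (Fin n → ℤ) → Laurent n R → Prop
  | dominant (lam : Fin n → ℤ) (hanti : Antitone lam) (hnonneg : ∀ i, 0 ≤ lam i) :
      IsKey t op lam (mon lam)
  | step (g : Generator n) (v : Fin n → ℤ) (f : Laurent n R) (huse : t.Uses g)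
      (hasc : t.Ascends v g) (hf : IsKey t op v f) : IsKey t op (g.act v) (op g f)

open Classical in
/-- The key polynomial `K_v^♡`; it is `0` if the recursion never reaches the index `v`. -/
def KeyType.key (t : KeyType R) (v : Fin n → ℤ) : Laurent n R :=
  if h : ∃ f : Laurent n R, IsKey t t.pi v f then h.choose else 0

open Classical in
/-- The key polynomial `K̂_v^♡` of the second family; it is `0` if the recursion never reaches the
index `v`. -/
def KeyType.keyHat (t : KeyType R) (v : Fin n → ℤ) : Laurent n R :=
  if h : ∃ f : Laurent n R, IsKey t t.piHat v f then h.choose else 0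

end Key

section ScalarProduct

variable {n : ℕ} {R : Type*} [CommRing R]

/-- The constant term. -/
def CT (f : Laurent n R) : R := f.coeff 0

/-- The product `∏_{i < j} (x_i - x_j) (1 - 1 / (x_i x_j))`. It is the Weyl denominator `Δ^D`. -/
def denomD : Laurent n R :=
  ∏ i : Fin n, ∏ j ∈ Finset.Ioi i, (x i - x j) * (1 - xInv i * xInv j)

/-- The Weyl denominator `Δ^C = ∏_i (x_i - x_i⁻¹) ∏_{i < j} (x_i - x_j) (1 - 1 / (x_i x_j))`. -/
def denomC : Laurent n R := (∏ i : Fin n, (x i - xInv i)) * denomD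

/-- The vector `ρ^C = ρ^BC = [n, …, 2, 1]`. -/
def rhoC : Fin n → ℤ := fun i => (n : ℤ) - (i : ℕ)

/-- The vector `ρ^D = [n - 1, …, 1, 0]`. -/
def rhoD : Fin n → ℤ := fun i => (n : ℤ) - 1 - (i : ℕ)

/-- The product `x^ρ Δ^B`. Since `ρ^B = ρ^D + [1/2, …, 1/2]` and
`Δ^B = ∏_i (x_i^(1/2) - x_i^(-1/2)) · Δ^D`, the half-integral exponents combine through
`x_i^(1/2) (x_i^(1/2) - x_i^(-1/2)) = x_i - 1`. -/
def weightB : Laurent n R := mon rhoD * (∏ i : Fin n, (x i - 1)) * denomD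

/-- The coefficients of the formal power series `∏_i (1 + β x_i)⁻¹ = ∏_i ∑_k (-β x_i)^k`: the
coefficient of `x^m` is `∏_i (-β)^(m_i)` if all `m_i ≥ 0`, and zero otherwise. -/
def invSeries (β : R) (m : Fin n → ℤ) : R :=
  ∏ i, if 0 ≤ m i then (-β) ^ (m i).toNat else 0

/-- The product of a Laurent polynomial and a formal series `∑_m S(m) x^m`, again as the family of
its coefficients. -/
def mulSeries (f : Laurent n R) (S : (Fin n → ℤ) → R) (m : Fin n → ℤ) : R :=
  f.coeff.sum fun e c => c * S (m - e)

/-- The product `∏_{i < j} (1 - x_i x_j⁻¹)`. -/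
def weightA : Laurent n R := ∏ i : Fin n, ∏ j ∈ Finset.Ioi i, (1 - x i * xInv j)

/-- The Laurent polynomial `g(x_n⁻¹, …, x_1⁻¹)`. -/
def reverseInvert (g : Laurent n R) : Laurent n R :=
  onMonomials (fun v i => -v (Fin.rev i)) g

/-- The scalar products: `(f, g)^♡ = CT(f g x^ρ Δ^♡)` for the types `B`, `C`, `D`, `BC`, where
`Δ^BC = Δ^C ∏_i (1 + β x_i)⁻¹` is expanded as a formal series in the `β x_i`, and
`(f, g)^A = CT(f(x_1, …, x_n) g(x_n⁻¹, …, x_1⁻¹) ∏_{i < j} (1 - x_i x_j⁻¹))`. -/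
def KeyType.pairing : KeyType R → Laurent n R → Laurent n R → R
  | .A, f, g => CT (f * reverseInvert g * weightA)
  | .B, f, g => CT (f * g * weightB)
  | .C, f, g => CT (f * g * (mon rhoC * denomC))
  | .D, f, g => CT (f * g * (mon rhoD * denomD))
  | .BC β, f, g => mulSeries (f * g * (mon rhoC * denomC)) (invSeries β) 0

end ScalarProduct

/-- The index `v` lies in the `D_n`-orbit of a partition, that is, `K_v^D` and `K̂_v^D` are defined:
`v` has a zero component, or an even number of negative components. -/
def IsIndexD {n : ℕ} (v : Fin n → ℤ) : Prop :=
  (∃ i, v i = 0) ∨ Even (Finset.univ.filter fun i => v i < 0).card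

end

end KeyPoly

/-!
The operators of all types are instances of one family. With `α` the root of a generator `g` (the
long root `2 e_n` for `s_n`), the operator `π_g` is characterized by
`(f π_g) (1 - x^(-α)) = (1 + b) f - (x^(-α) + b) f^g`, where `b = β x_n⁻¹` for `s_n` and `b = 0`
otherwise. Type `C` is the case `β = 0` of type `BC`, and type `B` is the case `β = 1`, because
`1 + x_n⁻¹` then cancels. The scalar products specialize in the same way: up to the sign `(-1)^n`
they are `(f, g) = Θ(f g)`, where `Θ` multiplies with the weight of the root system and takes the
constant term twisted by `∏ (1 + β x_i)⁻¹`. In type `A` the second argument is first transformed by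
the involution that sends `v` to `[-v_n, …, -v_1]`, which exchanges `π_i` and `π_{n-i}`. It is
therefore enough to show `Θ(K_v K̂_u) = δ_{-v,u}` for the root systems `A`, `BC`, `D`
(`GenKey.form_mul`). Four facts carry the proof.

* Self-adjointness, `Θ((f π_g) h) = Θ(f (h π_g))` (`RootKind.form_demazure`): the weight is
  `1 - x^α` times a factor that is invariant under `g`, and the twisted constant term obeys a
  reflection formula (`seriesCT_sub`).
* Triangularity (`GenKey.coeff_eq`): `x^w π_g` is supported on the segment from `w` to its mirror
  image, so by strict convexity of the Euclidean norm `K_v` is supported in the ball of radius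
  `|v|`, and the recursion controls its coefficients on the boundary sphere.
* Positivity (`RootKind.form_mon_add`): a monomial of the weight has the form `x^γ` with `γ` paired
  nonnegatively with every dominant vector. Hence `Θ(x^(w + λ))` with `λ` dominant and `|w| ≤ |λ|`
  vanishes unless `w = -λ`.
* Descent (`GenKey.descent`): `K_v π_g = K_v` unless the step from `v` to its image under `g`
  ascends. It follows from the braid relations of the operators; no independence of `K_v` from
  the path of the recursion is presupposed.

The orthogonality is now an induction along the recursion of `K̂_u`. For dominant `u` it is read off
from triangularity and positivity, after moving the operators of `K_v` to the other side if
`|v| > |u|`. In a step, `Θ(f (h π̂_g)) = Θ((f π_g) h) - Θ(f h)` is zero if `f = K_v` is fixed by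
`π_g`, and reduces to two known values for `h` if `K_v π_g` is again a key polynomial.

Last, the recursion over all ascents, with the ascents of type `D` measured by word length, is
compared with the one used here, in which an ascent is a positive value of the coroot
(`KeyType.Index.ascends_iff`).
-/

namespace KeyPoly

noncomputable section

open AddMonoidAlgebra

variable {n : ℕ}

section

variable {R : Type*} [CommRing R]

/-! ### Laurent polynomials -/

theorem mon_zero : (mon 0 : Laurent n R) = 1 := rfl

theorem mon_add (v w : Fin n → ℤ) : (mon (v + w) : Laurent n R) = mon v * mon w := by
  simp [mon, single_mul_single]

theorem prod_mon {ι : Type*} (s : Finset ι) (e : ι → Fin n → ℤ) :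
    (∏ i ∈ s, mon (e i) : Laurent n R) = mon (∑ i ∈ s, e i) := by
  classical
  induction s using Finset.induction_on with
  | empty => simp [mon_zero]
  | insert i s hi ih => rw [Finset.prod_insert hi, Finset.sum_insert hi, mon_add, ih]

theorem mon_mul_mon_neg (v : Fin n → ℤ) : (mon v * mon (-v) : Laurent n R) = 1 := by
  rw [← mon_add, add_neg_cancel, mon_zero]

theorem const_mul (r : R) (f : Laurent n R) : const r * f = r • f := by
  ext w
  simp [const]

theorem coeff_mon (v u : Fin n → ℤ) : (mon v : Laurent n R).coeff u = if v = u then 1 else 0 := by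
  classical
  simp [mon, Finsupp.single_apply]

/-- Linear maps on Laurent polynomials are determined by their values on monomials. -/
theorem linearMap_ext_mon {M : Type*} [AddCommMonoid M] [Module R M]
    {φ ψ : Laurent n R →ₗ[R] M} (h : ∀ w, φ (mon w) = ψ (mon w)) (f : Laurent n R) :
    φ f = ψ f := by
  induction f using AddMonoidAlgebra.induction_linear with
  | zero => simp
  | add f g hf hg => simp [hf, hg]
  | single w r =>
    have : (single w r : Laurent n R) = r • mon w := by simp [mon]
    rw [this, map_smul, map_smul, h]

/-- The linear extension to Laurent polynomials of a family indexed by the monomials. -/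
def extend {M : Type*} [AddCommMonoid M] [Module R M] (F : (Fin n → ℤ) → M) :
    Laurent n R →ₗ[R] M :=
  Finsupp.linearCombination R F ∘ₗ (coeffLinearEquiv R).toLinearMap

theorem extend_apply {M : Type*} [AddCommMonoid M] [Module R M] (F : (Fin n → ℤ) → M)
    (f : Laurent n R) : extend F f = f.coeff.sum fun w c => c • F w := rfl

theorem extend_mon {M : Type*} [AddCommMonoid M] [Module R M] (F : (Fin n → ℤ) → M)
    (w : Fin n → ℤ) : extend (R := R) F (mon w) = F w := by
  simp [extend_apply, mon]

theorem eq_extend {M : Type*} [AddCommMonoid M] [Module R M] (φ : Laurent n R →ₗ[R] M)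
    (f : Laurent n R) : φ f = f.coeff.sum fun w c => c • φ (mon w) := by
  rw [← extend_apply]
  exact linearMap_ext_mon (fun w => (extend_mon (fun w => φ (mon w)) w).symm) f

/-- The binomials `1 - x^α` with `α ≠ 0` are not zero divisors, over any ring: a Laurent polynomial
that is annihilated would have coefficients that are constant along the infinite sequence
`w, w - α, w - 2α, …`. -/
theorem one_sub_mon_mem_nonZeroDivisors {α : Fin n → ℤ} (hα : α ≠ 0) :
    (1 - mon α : Laurent n R) ∈ nonZeroDivisors (Laurent n R) := by
  rw [mem_nonZeroDivisors_iff_right]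
  intro f hf
  have h1 : f = f * mon α := by linear_combination hf
  have h2 : ∀ w, f.coeff (w + α) = f.coeff w := by
    intro w
    conv_lhs => rw [h1]
    simp [mon, coeff_mul_single_apply]
  have h3 : ∀ (w) (k : ℕ), f.coeff (w + k • α) = f.coeff w := by
    intro w k
    induction k with
    | zero => simp
    | succ k ih => rw [succ_nsmul, ← add_assoc, h2, ih]
  ext w
  by_contra hw
  have hinj : Function.Injective fun k : ℕ => w + k • α := by
    intro k l hkl
    have := add_left_cancel hkl
    obtain ⟨i, hi⟩ := Function.ne_iff.mp hα
    have h4 := congrFun this i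
    simp only [Pi.smul_apply, nsmul_eq_mul] at h4
    exact_mod_cast mul_right_cancel₀ hi h4
  refine Set.infinite_range_of_injective hinj (f.coeff.support.finite_toSet.subset ?_)
  rintro _ ⟨k, rfl⟩
  rw [SetLike.mem_coe, Finsupp.mem_support_iff, h3]
  exact hw

/-- A monomial is a unit, hence not a zero divisor. -/
theorem mon_mem_nonZeroDivisors (α : Fin n → ℤ) :
    (mon α : Laurent n R) ∈ nonZeroDivisors (Laurent n R) :=
  (IsUnit.of_mul_eq_one _ (mon_mul_mon_neg α)).mem_nonZeroDivisors

theorem quot_eq {a d q : Laurent n R} (hd : d ∈ nonZeroDivisors (Laurent n R)) (h : q * d = a) :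
    quot a d = q := by
  have hex : ∃ q : Laurent n R, q * d = a := ⟨q, h⟩
  rw [quot, dif_pos hex]
  exact (mul_cancel_right_mem_nonZeroDivisors hd).mp (hex.choose_spec.trans h.symm)

/-- The substitution of monomials for monomials induced by an endomorphism of `ℤ^n`. -/
def subst (φ : (Fin n → ℤ) →+ (Fin n → ℤ)) : Laurent n R →ₐ[R] Laurent n R :=
  mapDomainAlgHom R R φ

theorem subst_apply (φ : (Fin n → ℤ) →+ (Fin n → ℤ)) (f : Laurent n R) :
    subst φ f = onMonomials φ f := rfl

theorem subst_mon (φ : (Fin n → ℤ) →+ (Fin n → ℤ)) (w : Fin n → ℤ) :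
    subst φ (mon w : Laurent n R) = mon (φ w) := by
  simp [subst_apply, onMonomials, mon, mapDomain_single]

theorem subst_subst {φ ψ χ : (Fin n → ℤ) →+ (Fin n → ℤ)} (h : ∀ v, φ (ψ v) = χ v)
    (f : Laurent n R) : subst φ (subst ψ f) = subst χ f := by
  refine linearMap_ext_mon (φ := (subst φ).toLinearMap ∘ₗ (subst ψ).toLinearMap)
    (ψ := (subst χ).toLinearMap) (fun w => ?_) f
  simp [subst_mon, h]

/-! ### Generators as reflections -/

namespace Generator

/-- The coroot of a generator `g`, as a linear form on `ℤ^n`: `g` sends `v` to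
`v - ht v • root`, so that the sign of `ht v` tells on which side of the mirror `v` lies. -/
def ht : Generator n → (Fin n → ℤ) →+ ℤ
  | .s i j _ => Pi.evalAddMonoidHom (fun _ => ℤ) i - Pi.evalAddMonoidHom (fun _ => ℤ) j
  | .neg i _ => Pi.evalAddMonoidHom (fun _ => ℤ) i
  | .tau i j _ _ => Pi.evalAddMonoidHom (fun _ => ℤ) i + Pi.evalAddMonoidHom (fun _ => ℤ) j

/-- The simple root of a generator. For `s_n` the long root `2 e_n` is chosen, so that the coroot
is `v ↦ v_n`. -/
def root : Generator n → Fin n → ℤ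
  | .s i j _ => Pi.single i 1 - Pi.single j 1
  | .neg i _ => Pi.single i 2
  | .tau i j _ _ => Pi.single i 1 + Pi.single j 1

/-- Half of the root, for the generator `s_n`; irrelevant (and set to `0`) for the others. -/
def half : Generator n → Fin n → ℤ
  | .neg i _ => Pi.single i 1
  | _ => 0

/-- The parameter `β` for the generator `s_n`, and `0` for the others. -/
def coef (β : R) : Generator n → R
  | .neg _ _ => β
  | _ => 0

@[simp] theorem ht_s (i j : Fin n) (h) (v : Fin n → ℤ) : (Generator.s i j h).ht v = v i - v j := rfl
@[simp] theorem ht_neg (i : Fin n) (h) (v : Fin n → ℤ) : (Generator.neg i h).ht v = v i := rfl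
@[simp] theorem ht_tau (i j : Fin n) (h h') (v : Fin n → ℤ) :
    (Generator.tau i j h h').ht v = v i + v j := rfl

theorem ne_of_succ_eq {i j : Fin n} (h : (i : ℕ) + 1 = j) : i ≠ j := by
  rintro rfl; omega

theorem ne_of_last {i j : Fin n} (h : (i : ℕ) + 2 = n) (h' : (j : ℕ) + 1 = n) : i ≠ j := by
  rintro rfl; omega

theorem act_eq (g : Generator n) (v : Fin n → ℤ) : g.act v = v - g.ht v • g.root := by
  ext p
  cases g with
  | s i j h =>
    have := ne_of_succ_eq h
    rcases eq_or_ne p j with rfl | hj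
    · simp [act, root, this.symm]
    · rcases eq_or_ne p i with rfl | hi
      · simp [act, root, hj]
      · simp [act, root, hi, hj]
  | neg i h =>
    rcases eq_or_ne p i with rfl | hi
    · simp [act, root]; ring
    · simp [act, root, hi]
  | tau i j h h' =>
    have := ne_of_last h h'
    rcases eq_or_ne p j with rfl | hj
    · simp [act, root, this.symm]
    · rcases eq_or_ne p i with rfl | hi
      · simp [act, root, hj]
      · simp [act, root, hi, hj]

@[simp] theorem ht_root (g : Generator n) : g.ht g.root = 2 := by
  cases g with
  | s i j h => simp [root, ne_of_succ_eq h, (ne_of_succ_eq h).symm]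
  | neg i h => simp [root]
  | tau i j h h' => simp [root, ne_of_last h h', (ne_of_last h h').symm]

theorem root_ne_zero (g : Generator n) : g.root ≠ 0 := by
  intro h
  have := g.ht_root
  rw [h, map_zero] at this
  omega

@[simp] theorem ht_act (g : Generator n) (v : Fin n → ℤ) : g.ht (g.act v) = -g.ht v := by
  rw [act_eq, map_sub, map_zsmul, ht_root, smul_eq_mul]; ring

@[simp] theorem act_act (g : Generator n) (v : Fin n → ℤ) : g.act (g.act v) = v := by
  rw [act_eq g (g.act v), ht_act, act_eq]; module

theorem act_neg (g : Generator n) (v : Fin n → ℤ) : g.act (-v) = -g.act v := by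
  simp only [act_eq, map_neg]; module

theorem act_of_ht_eq_zero {g : Generator n} {v : Fin n → ℤ} (h : g.ht v = 0) : g.act v = v := by
  rw [act_eq, h, zero_smul, sub_zero]

/-- The action of a generator as an endomorphism of `ℤ^n`. -/
def actHom (g : Generator n) : (Fin n → ℤ) →+ (Fin n → ℤ) where
  toFun := g.act
  map_zero' := by simp [act_eq]
  map_add' v w := by simp only [act_eq, map_add]; module

@[simp] theorem actHom_apply (g : Generator n) (v : Fin n → ℤ) : g.actHom v = g.act v := rfl

theorem coef_eq_zero_or (β : R) (g : Generator n) :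
    g.coef β = 0 ∨ g.root = g.half + g.half := by
  cases g with
  | s i j h => exact .inl rfl
  | neg i h => right; rw [half, root, ← Pi.single_add]; rfl
  | tau i j h h' => exact .inl rfl

theorem two_mul_dot_root (g : Generator n) (v : Fin n → ℤ) :
    2 * (v ⬝ᵥ g.root) = g.ht v * (g.root ⬝ᵥ g.root) := by
  cases g with
  | s i j h =>
    have := ne_of_succ_eq h
    simp [root, this, this.symm]; ring
  | neg i h => simp [root]; ring
  | tau i j h h' =>
    have := ne_of_last h h'
    simp [root, this, this.symm]; ring

theorem dot_root_pos (g : Generator n) : 0 < g.root ⬝ᵥ g.root := by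
  have h : 0 ≤ g.root ⬝ᵥ g.root := by
    simp only [dotProduct]; exact Finset.sum_nonneg fun i _ => mul_self_nonneg _
  exact lt_of_le_of_ne h fun h0 => g.root_ne_zero (dotProduct_self_eq_zero.mp h0.symm)

end Generator

/-- The squared Euclidean norm. -/
def normSq (v : Fin n → ℤ) : ℤ := v ⬝ᵥ v

theorem normSq_sub_smul_root (g : Generator n) (v : Fin n → ℤ) (m : ℤ) :
    normSq (v - m • g.root) = normSq v + m * (m - g.ht v) * (g.root ⬝ᵥ g.root) := by
  have h := g.two_mul_dot_root v
  simp only [normSq, sub_dotProduct, dotProduct_sub, smul_dotProduct, dotProduct_smul,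
    smul_eq_mul, dotProduct_comm g.root v]
  linear_combination -m * h

@[simp] theorem normSq_act (g : Generator n) (v : Fin n → ℤ) : normSq (g.act v) = normSq v := by
  rw [g.act_eq, normSq_sub_smul_root]; ring

theorem normSq_nonneg (v : Fin n → ℤ) : 0 ≤ normSq v := by
  simp only [normSq, dotProduct]
  exact Finset.sum_nonneg fun i _ => mul_self_nonneg _

theorem normSq_eq_zero {v : Fin n → ℤ} : normSq v = 0 ↔ v = 0 := dotProduct_self_eq_zero

@[simp] theorem normSq_neg (v : Fin n → ℤ) : normSq (-v) = normSq v := by simp [normSq]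

/-! ### Isobaric divided differences -/

/-- The Laurent polynomial `(1 - x^(-k α)) / (1 - x^(-α))`, for `k ∈ ℤ`: it is
`1 + x^(-α) + ⋯ + x^(-(k-1) α)` for `k ≥ 0`, and `-(x^α + ⋯ + x^(-k α))` for `k < 0`. -/
def geom (α : Fin n → ℤ) (k : ℤ) : Laurent n R :=
  ∑ m ∈ Finset.Ico 0 k, mon (-(m • α)) - ∑ m ∈ Finset.Ico k 0, mon (-(m • α))

theorem geom_succ (α : Fin n → ℤ) (k : ℤ) :
    (geom α (k + 1) : Laurent n R) = geom α k + mon (-(k • α)) := by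
  unfold geom
  rcases le_or_gt 0 k with hk | hk
  · rw [Finset.Ico_eq_empty_of_le (show (0 : ℤ) ≤ k + 1 by omega), Finset.Ico_eq_empty_of_le hk,
      ← Finset.insert_Ico_right_eq_Ico_add_one hk, Finset.sum_insert (by simp)]
    simp only [Finset.sum_empty, sub_zero]
    ring
  · rw [Finset.Ico_eq_empty_of_le (show k + 1 ≤ (0 : ℤ) by omega), Finset.Ico_eq_empty_of_le hk.le,
      ← Finset.insert_Ico_add_one_left_eq_Ico hk, Finset.sum_insert (by simp)]
    ring

theorem geom_mul (α : Fin n → ℤ) (k : ℤ) :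
    (geom α k : Laurent n R) * (1 - mon (-α)) = 1 - mon (-(k • α)) := by
  have hstep (k : ℤ) : (mon (-((k + 1) • α)) : Laurent n R) = mon (-(k • α)) * mon (-α) := by
    rw [← mon_add]; congr 1; module
  induction k using Int.induction_on with
  | zero => simp [geom, mon_zero]
  | succ k ih => rw [geom_succ, hstep, add_mul, ih]; ring
  | pred k ih =>
    have h1 := geom_succ (R := R) α (-(k : ℤ) - 1)
    have h2 := hstep (-(k : ℤ) - 1)
    rw [sub_add_cancel] at h1 h2
    rw [h1, h2] at ih
    linear_combination ih

/-- The isobaric divided difference `π_g` with parameter `β`, given by its values on monomials. -/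
def demazure (β : R) (g : Generator n) : Laurent n R →ₗ[R] Laurent n R :=
  extend fun w => mon w * geom g.root (g.ht w + 1) +
    g.coef β • (mon (w - g.half) * geom g.root (g.ht w))

theorem demazure_mon (β : R) (g : Generator n) (w : Fin n → ℤ) :
    demazure β g (mon w) = mon w * geom g.root (g.ht w + 1) +
      g.coef β • (mon (w - g.half) * geom g.root (g.ht w)) :=
  extend_mon _ w

namespace Generator

/-- The substitution `f ↦ f^g` on Laurent polynomials. -/
def sub (g : Generator n) : Laurent n R →ₐ[R] Laurent n R := subst g.actHom

theorem sub_apply (g : Generator n) (f : Laurent n R) : g.sub f = onMonomials g.act f := rfl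

@[simp] theorem sub_mon (g : Generator n) (w : Fin n → ℤ) :
    g.sub (mon w : Laurent n R) = mon (g.act w) := subst_mon _ w

@[simp] theorem sub_sub (g : Generator n) (f : Laurent n R) : g.sub (g.sub f) = f := by
  have := subst_subst (R := R) (φ := g.actHom) (ψ := g.actHom) (χ := AddMonoidHom.id _)
    (fun v => g.act_act v) f
  refine this.trans (linearMap_ext_mon (φ := (subst _).toLinearMap) (ψ := LinearMap.id)
    (fun w => ?_) f)
  simp [subst_mon]

/-- The Laurent polynomial `β x_n⁻¹` for the generator `s_n`, and `0` for the others. -/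
def bTerm (β : R) (g : Generator n) : Laurent n R := g.coef β • mon (-g.half)

theorem coef_smul_half_eq (β : R) (g : Generator n) (v : Fin n → ℤ) :
    (g.coef β • mon (v + g.root - g.half) : Laurent n R) = g.coef β • mon (v + g.half) := by
  rcases g.coef_eq_zero_or β with h | h
  · simp [h]
  · rw [h]; congr 2; module

end Generator

theorem act_root (g : Generator n) : g.act g.root = -g.root := by
  rw [g.act_eq, g.ht_root]; module

theorem sub_bTerm (β : R) (g : Generator n) : g.sub (g.bTerm β) = mon g.root * g.bTerm β := by
  have h : (g.coef β • mon (g.act (-g.half)) : Laurent n R) = g.coef β • mon g.half := by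
    cases g with
    | neg i h =>
      congr 2
      ext p
      rcases eq_or_ne p i with rfl | hp <;> simp [Generator.act, Generator.half, *]
    | _ => simp [Generator.coef]
  have h2 := g.coef_smul_half_eq β 0
  rw [zero_add, zero_add, sub_eq_add_neg, mon_add] at h2
  rw [Generator.bTerm, map_smul, Generator.sub_mon, h, mul_smul_comm, h2]

/-- The equation that characterizes `π_g`. -/
theorem demazure_mul (β : R) (g : Generator n) (f : Laurent n R) :
    demazure β g f * (1 - mon (-g.root)) =
      (1 + g.bTerm β) * f - (mon (-g.root) + g.bTerm β) * g.sub f := by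
  refine linearMap_ext_mon
    (φ := LinearMap.mulRight R (1 - mon (-g.root)) ∘ₗ demazure β g)
    (ψ := LinearMap.mulLeft R (1 + g.bTerm β) -
      LinearMap.mulLeft R (mon (-g.root) + g.bTerm β) ∘ₗ g.sub.toLinearMap) (fun w => ?_) f
  have h1 := geom_mul (R := R) g.root (g.ht w + 1)
  have h2 := geom_mul (R := R) g.root (g.ht w)
  have e1 : (mon (-((g.ht w + 1) • g.root)) : Laurent n R) =
      mon (-(g.ht w • g.root)) * mon (-g.root) := by rw [← mon_add]; congr 1; module
  have e2 : (mon (g.act w) : Laurent n R) = mon w * mon (-(g.ht w • g.root)) := by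
    rw [← mon_add, g.act_eq, sub_eq_add_neg]
  have e3 : (mon (w - g.half) : Laurent n R) = mon w * mon (-g.half) := by
    rw [← mon_add, sub_eq_add_neg]
  simp only [LinearMap.comp_apply, LinearMap.mulRight_apply, LinearMap.sub_apply,
    LinearMap.mulLeft_apply, AlgHom.toLinearMap_apply, Generator.sub_mon, demazure_mon,
    Generator.bTerm, ← const_mul]
  rw [e2, e3]
  rw [e1] at h1
  linear_combination mon w * h1 + const (g.coef β) * mon w * mon (-g.half) * h2

theorem one_sub_root_mem (g : Generator n) :
    (1 - mon (-g.root) : Laurent n R) ∈ nonZeroDivisors (Laurent n R) :=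
  one_sub_mon_mem_nonZeroDivisors (neg_ne_zero.mpr g.root_ne_zero)

/-- The images of `π_g` are invariant under `g`. -/
theorem sub_demazure (β : R) (g : Generator n) (f : Laurent n R) :
    g.sub (demazure β g f) = demazure β g f := by
  have h := demazure_mul β g f
  have h' := congrArg g.sub h
  have hinv : (mon g.root * mon (-g.root) : Laurent n R) = 1 := mon_mul_mon_neg _
  simp only [map_mul, map_sub, map_add, map_one, Generator.sub_mon, Generator.sub_sub, sub_bTerm,
    g.act_neg, act_root, neg_neg] at h'
  refine (mul_cancel_right_mem_nonZeroDivisors (one_sub_root_mem g)).mp ?_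
  rw [h]
  linear_combination -mon (-g.root) * h' - (g.sub (demazure β g f) - f
    + g.bTerm β * g.sub f - g.bTerm β * f) * hinv

theorem demazure_of_sub_eq (β : R) (g : Generator n) {f : Laurent n R} (h : g.sub f = f) :
    demazure β g f = f := by
  refine (mul_cancel_right_mem_nonZeroDivisors (one_sub_root_mem g)).mp ?_
  rw [demazure_mul, h]; ring

theorem demazure_demazure (β : R) (g : Generator n) (f : Laurent n R) :
    demazure β g (demazure β g f) = demazure β g f :=
  demazure_of_sub_eq β g (sub_demazure β g f)

/-- The parameter `β` for which the operators of a given type are those of type `BC`. -/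
def KeyType.beta : KeyType R → R
  | .B => 1
  | .BC β => β
  | _ => 0

theorem x_mul_xInv (i : Fin n) : (x i * xInv i : Laurent n R) = 1 := by
  rw [x, xInv, Pi.single_neg, mon_mul_mon_neg]

theorem const_zero : (const 0 : Laurent n R) = 0 := by simp [const]

theorem const_one : (const 1 : Laurent n R) = 1 := rfl

theorem x_eq_one_mem (i : Fin n) : (x i - 1 : Laurent n R) ∈ nonZeroDivisors (Laurent n R) := by
  have h := one_sub_mon_mem_nonZeroDivisors (R := R)
    (show (Pi.single i 1 : Fin n → ℤ) ≠ 0 by simp)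
  rw [show (x i - 1 : Laurent n R) = -1 * (1 - mon (Pi.single i 1)) by rw [x]; ring]
  exact mul_mem isUnit_one.neg.mem_nonZeroDivisors h

theorem pi_eq_demazure (t : KeyType R) {g : Generator n} (h : t.Uses g) (f : Laurent n R) :
    t.pi g f = demazure t.beta g f := by
  have key := demazure_mul t.beta g f
  have hd := one_sub_root_mem (R := R) g
  cases g with
  | s i j hij =>
    have e : (mon (-(Generator.s i j hij).root) : Laurent n R) = xInv i * x j := by
      rw [x, xInv, ← mon_add]; congr 1; rw [Generator.root, Pi.single_neg]; abel
    have hb : (Generator.s i j hij).bTerm t.beta = 0 := by simp [Generator.bTerm, Generator.coef]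
    have hx := x_mul_xInv (R := R) i
    rw [e, hb] at key
    rw [e] at hd
    have hd' : (x i - x j : Laurent n R) ∈ nonZeroDivisors (Laurent n R) := by
      have : (x i - x j : Laurent n R) = x i * (1 - xInv i * x j) := by
        linear_combination x j * hx
      rw [this]
      exact mul_mem (mon_mem_nonZeroDivisors _) hd
    have : t.pi (Generator.s i j hij) f =
        quot (x i * f - x j * onMonomials (Generator.s i j hij).act f) (x i - x j) := by
      cases t <;> rfl
    rw [this]
    refine quot_eq hd' ?_
    rw [← Generator.sub_apply]
    linear_combination x i * key + (x j * (demazure t.beta (Generator.s i j hij) f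
      - (Generator.s i j hij).sub f)) * hx
  | neg i hi =>
    have e : (mon (-(Generator.neg i hi).root) : Laurent n R) = xInv i * xInv i := by
      rw [xInv, ← mon_add, ← Pi.single_add, Generator.root, ← Pi.single_neg]; rfl
    have hb : (Generator.neg i hi).bTerm t.beta = const t.beta * (xInv i : Laurent n R) := by
      rw [Generator.bTerm, Generator.coef, Generator.half, xInv, const_mul, Pi.single_neg]
    have hx := x_mul_xInv (R := R) i
    rw [e, hb] at key
    rw [e] at hd
    have hd' : (x i - xInv i : Laurent n R) ∈ nonZeroDivisors (Laurent n R) := by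
      have : (x i - xInv i : Laurent n R) = x i * (1 - xInv i * xInv i) := by
        linear_combination xInv i * hx
      rw [this]
      exact mul_mem (mon_mem_nonZeroDivisors _) hd
    set P := demazure t.beta (Generator.neg i hi) f with hP
    have hBC : P * (x i - xInv i) =
        (x i + const t.beta) * f - (xInv i + const t.beta) * (Generator.neg i hi).sub f := by
      linear_combination x i * key + (xInv i * P + const t.beta * f
        - (const t.beta + xInv i) * (Generator.neg i hi).sub f) * hx
    cases t with
    | A => exact h.elim
    | D => exact h.elim
    | BC β => exact quot_eq hd' hBC
    | C =>
      rw [show (KeyType.C : KeyType R).beta = 0 from rfl, const_zero, add_zero, add_zero] at hBC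
      exact quot_eq hd' hBC
    | B =>
      rw [show (KeyType.B : KeyType R).beta = 1 from rfl, const_one] at hBC
      -- cancel the common factor `1 + x_n⁻¹`
      have h1 : (x i - xInv i : Laurent n R) = (x i - 1) * (1 + xInv i) := by
        linear_combination -hx
      have h2 := (mul_mem_nonZeroDivisors.mp (h1 ▸ hd')).2
      refine quot_eq (x_eq_one_mem i) ((mul_cancel_right_mem_nonZeroDivisors h2).mp ?_)
      rw [mul_assoc, ← h1, hBC, ← Generator.sub_apply]
      linear_combination -f * hx
  | tau i j hi hj =>
    have e : (mon (-(Generator.tau i j hi hj).root) : Laurent n R) = xInv i * xInv j := by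
      rw [xInv, xInv, ← mon_add, Generator.root, neg_add, Pi.single_neg, Pi.single_neg]
    have hb : (Generator.tau i j hi hj).bTerm t.beta = 0 := by
      simp [Generator.bTerm, Generator.coef]
    rw [e, hb] at key
    rw [e] at hd
    cases t with
    | D =>
      refine quot_eq hd ?_
      rw [key, Generator.sub_apply]; ring
    | _ => exact h.elim

/-! ### Coefficients of `π_g f` on the sphere of largest radius -/

theorem coeff_mon_mul_geom (w α u : Fin n → ℤ) (k : ℤ) :
    (mon w * geom α k : Laurent n R).coeff u =
      ∑ m ∈ Finset.Ico 0 k, (if w - m • α = u then 1 else 0) -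
        ∑ m ∈ Finset.Ico k 0, (if w - m • α = u then 1 else 0) := by
  simp only [geom, mul_sub, Finset.mul_sum, ← mon_add, coeff_sub, coeff_sum, Finsupp.coe_sub,
    Pi.sub_apply, Finsupp.finsetSum_apply, coeff_mon, ← sub_eq_add_neg]

/-- The reflection of `u` to the nonnegative side of the mirror of `g`. -/
def Generator.fold (g : Generator n) (u : Fin n → ℤ) : Fin n → ℤ :=
  if g.ht u < 0 then g.act u else u

@[simp] theorem normSq_fold (g : Generator n) (u : Fin n → ℤ) : normSq (g.fold u) = normSq u := by
  unfold Generator.fold; split_ifs <;> simp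

/-- The monomials of `x^w π_g` lie on the segment from `w` to its mirror image. By strict convexity
of the norm only the end points of the segment can be as far from the origin as `w`. -/
theorem coeff_demazure_mon (β : R) (g : Generator n) {w u : Fin n → ℤ}
    (h : normSq w ≤ normSq u) :
    (demazure β g (mon w)).coeff u = if w = g.fold u then 1 else 0 := by
  have hpos := g.dot_root_pos
  have hβ : (g.coef β • (mon (w - g.half) * geom g.root (g.ht w)) : Laurent n R).coeff u = 0 := by
    rcases g.coef_eq_zero_or β with h0 | hh
    · simp [h0]
    · have hne (m : ℤ) (hm : (2 * m + 1) * (2 * m + 1 - 2 * g.ht w) < 0) :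
          w - g.half - m • g.root ≠ u := by
        rintro rfl
        have h1 := g.two_mul_dot_root w
        simp only [normSq, hh, sub_dotProduct, dotProduct_sub, smul_dotProduct, dotProduct_smul,
          smul_eq_mul, dotProduct_comm g.half w, add_dotProduct, dotProduct_add] at h h1 hpos
        have h2 : w ⬝ᵥ g.half = g.ht w * (g.half ⬝ᵥ g.half) := by linarith
        have h3 := mul_neg_of_neg_of_pos hm (show 0 < g.half ⬝ᵥ g.half by linarith)
        rw [h2] at h
        linarith
      rw [coeff_smul, Finsupp.smul_apply, coeff_mon_mul_geom, Finset.sum_eq_zero,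
        Finset.sum_eq_zero, sub_zero, smul_zero]
      · intro m hm
        rw [Finset.mem_Ico] at hm
        exact if_neg (hne m (by nlinarith))
      · intro m hm
        rw [Finset.mem_Ico] at hm
        exact if_neg (hne m (by nlinarith))
  have hin (m : ℤ) (hm : w - m • g.root = u) : 0 ≤ m * (m - g.ht w) := by
    rw [← hm, normSq_sub_smul_root] at h
    by_contra hlt
    nlinarith
  have hinj {m l : ℤ} (hml : m • g.root = l • g.root) : m = l := by
    have := congrArg g.ht hml
    simp only [map_zsmul, g.ht_root, smul_eq_mul] at this
    omega
  rw [demazure_mon, coeff_add, Finsupp.add_apply, hβ, add_zero, coeff_mon_mul_geom,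
    Finset.sum_eq_zero (s := Finset.Ico (g.ht w + 1) 0), sub_zero]
  · split_ifs with hw
    · have hmem : ∃ m ∈ Finset.Ico 0 (g.ht w + 1), w - m • g.root = u := by
        unfold Generator.fold at hw
        split_ifs at hw with hu
        · refine ⟨g.ht w, ?_, by rw [← g.act_eq, hw, g.act_act]⟩
          rw [hw, Finset.mem_Ico, g.ht_act]; omega
        · exact ⟨0, by rw [hw, Finset.mem_Ico]; omega, by simp [hw]⟩
      obtain ⟨m, hm, hmu⟩ := hmem
      rw [Finset.sum_eq_single_of_mem m hm, if_pos hmu]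
      intro l _ hlm
      refine if_neg fun hl => hlm (hinj ?_)
      rw [← hmu] at hl
      exact sub_right_injective hl
    · refine Finset.sum_eq_zero fun m hm => if_neg fun hmu => hw ?_
      rw [Finset.mem_Ico] at hm
      have h0 := hin m hmu
      have h1 : m = 0 ∨ m = g.ht w := by
        rcases eq_or_ne m 0 with h | h
        · exact .inl h
        · right; nlinarith [show 0 < m by omega, show m ≤ g.ht w by omega]
      unfold Generator.fold
      rcases h1 with rfl | rfl
      · rw [zero_smul, sub_zero] at hmu
        subst hmu
        rw [if_neg (by omega)]
      · rw [← g.act_eq] at hmu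
        subst hmu
        rw [g.act_act, g.ht_act]
        split_ifs with h2
        · rfl
        · exact (g.act_of_ht_eq_zero (by omega)).symm
  · intro m hm
    rw [Finset.mem_Ico] at hm
    refine if_neg fun hmu => ?_
    have := hin m hmu
    nlinarith

theorem coeff_demazure (β : R) (g : Generator n) {f : Laurent n R} {u : Fin n → ℤ}
    (h : ∀ w, f.coeff w ≠ 0 → normSq w ≤ normSq u) :
    (demazure β g f).coeff u = f.coeff (g.fold u) := by
  classical
  rw [eq_extend, Finsupp.sum, coeff_sum, Finsupp.finsetSum_apply]
  rw [Finset.sum_congr rfl (g := fun w => if w = g.fold u then f.coeff w else 0)]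
  · rw [Finset.sum_ite_eq']
    split_ifs with hm
    · rfl
    · exact (Finsupp.notMem_support_iff.mp hm).symm
  · intro w hw
    rw [coeff_smul, Finsupp.smul_apply, coeff_demazure_mon β g (h w (Finsupp.mem_support_iff.mp hw))]
    simp

/-- The Laurent polynomials whose exponents lie in a ball are stable under `π_g`. -/
theorem normSq_le_of_coeff_demazure_ne_zero (β : R) (g : Generator n) {f : Laurent n R} {N : ℤ}
    (h : ∀ w, f.coeff w ≠ 0 → normSq w ≤ N) (u : Fin n → ℤ)
    (hu : (demazure β g f).coeff u ≠ 0) : normSq u ≤ N := by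
  by_contra hlt
  rw [coeff_demazure β g fun w hw => (h w hw).trans (not_le.mp hlt).le] at hu
  have := h _ hu
  rw [normSq_fold] at this
  exact hlt this

/-! ### Braid relations -/

section Braid

variable {A : Type*} [CommRing A] (s t : A →+* A) {P Q : A → A}

theorem comm_of_mul_eq {X Y b c : A}
    (hP : ∀ f, P f * (1 - X) = (1 + b) * f - (X + b) * s f)
    (hQ : ∀ f, Q f * (1 - Y) = (1 + c) * f - (Y + c) * t f)
    (hX : t X = X) (hb : t b = b) (hY : s Y = Y) (hc : s c = c) (hst : ∀ f, s (t f) = t (s f))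
    (hX0 : 1 - X ∈ nonZeroDivisors A) (hY0 : 1 - Y ∈ nonZeroDivisors A) (f : A) :
    P (Q f) = Q (P f) := by
  have h1 := congrArg s (hQ f)
  have h2 := congrArg t (hP f)
  simp only [map_mul, map_sub, map_add, map_one, hX, hY, hb, hc] at h1 h2
  refine (mul_cancel_right_mem_nonZeroDivisors (mul_mem hX0 hY0)).mp ?_
  linear_combination (1 - Y) * hP (Q f) - (1 - X) * hQ (P f) + (1 + b) * hQ f
    - (X + b) * h1 - (1 + c) * hP f + (Y + c) * h2 + (X + b) * (Y + c) * hst f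

/-- The antisymmetrization formula for the operator of the longest element in type `A_2`. -/
theorem mul_eq_antisymm_A2 {X Y : A}
    (hP : ∀ f, P f * (1 - X) = f - X * s f) (hQ : ∀ f, Q f * (1 - Y) = f - Y * t f)
    (hY : s Y = X * Y) (hXY : s (X * Y) = Y) (hX : t X = X * Y)
    (hsP : ∀ f, s (P f) = P f) (f : A) :
    P (Q (P f)) * ((1 - X) * (1 - Y) * (1 - X * Y)) =
      f - X * s f - Y * t f + X * Y ^ 2 * t (s f) + X ^ 2 * Y * s (t f)
        - X ^ 2 * Y ^ 2 * s (t (s f)) := by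
  have h1 := congrArg s (hQ (P f))
  have h2 := congrArg t (hP f)
  simp only [map_mul, map_sub, map_one, hX, hY, hsP] at h1 h2
  have h3 := congrArg s h2
  simp only [map_mul, map_sub, map_one] at h3
  rw [← map_mul, hXY] at h3
  linear_combination (1 - Y) * (1 - X * Y) * hP (Q (P f)) + (1 - X * Y) * hQ (P f)
    - X * (1 - Y) * h1 + hP f - Y * h2 + X ^ 2 * Y * h3

theorem braid_of_mul_eq_A2 {X Y : A}
    (hP : ∀ f, P f * (1 - X) = f - X * s f) (hQ : ∀ f, Q f * (1 - Y) = f - Y * t f)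
    (hsY : s Y = X * Y) (hsXY : s (X * Y) = Y) (htX : t X = X * Y) (htXY : t (X * Y) = X)
    (hsP : ∀ f, s (P f) = P f) (htQ : ∀ f, t (Q f) = Q f)
    (hst : ∀ f, s (t (s f)) = t (s (t f)))
    (h0 : (1 - X) * (1 - Y) * (1 - X * Y) ∈ nonZeroDivisors A) (f : A) :
    P (Q (P f)) = Q (P (Q f)) := by
  refine (mul_cancel_right_mem_nonZeroDivisors h0).mp ?_
  have h1 := mul_eq_antisymm_A2 s t hP hQ hsY hsXY htX hsP f
  have h2 := mul_eq_antisymm_A2 t s hQ hP (by rw [htX, mul_comm]) (by rw [mul_comm, htXY])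
    (by rw [hsY, mul_comm]) htQ f
  linear_combination h1 - h2 - X ^ 2 * Y ^ 2 * hst f

/-- The braid relation of type `B_2`. Both sides, multiplied with the Weyl denominator, are
the alternating sum of the eight conjugates of `(1 + β y) (1 + β X y) f`, up to monomials. -/
theorem braid_of_mul_eq_B2 {X y β : A}
    (hP : ∀ f, P f * (1 - X) = f - X * s f)
    (hQ : ∀ f, Q f * (1 - y ^ 2) = (1 + β * y) * f - (y ^ 2 + β * y) * t f)
    (hsy : s y = X * y) (hsXy : s (X * y) = y) (htX : t X = X * y ^ 2)
    (htXy : t (X * y) = X * y) (htXyy : t (X * y ^ 2) = X) (hsXyy : s (X * y ^ 2) = X * y ^ 2)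
    (hsβ : s β = β) (htβ : t β = β)
    (hsP : ∀ f, s (P f) = P f) (htQ : ∀ f, t (Q f) = Q f)
    (hst : ∀ f, s (t (s (t f))) = t (s (t (s f))))
    (h0 : (1 - X) * (1 - y ^ 2) * (1 - X * y ^ 2) * (1 - (X * y) ^ 2) ∈ nonZeroDivisors A)
    (f : A) :
    P (Q (P (Q f))) = Q (P (Q (P f))) := by
  refine (mul_cancel_right_mem_nonZeroDivisors h0).mp ?_
  have hs (p : A) := congrArg s (hQ p)
  simp only [map_mul, map_sub, map_add, map_one, map_pow, hsβ, hsy] at hs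
  have hts (p : A) := congrArg t (hs p)
  have htXy' := htXy
  rw [map_mul] at htXy'
  simp only [map_mul, map_sub, map_add, map_one, map_pow, htβ, htXy'] at hts
  have ht (p : A) := congrArg t (hP p)
  simp only [map_mul, map_sub, map_one, htX] at ht
  have hst' (p : A) := congrArg s (ht p)
  have hsXyy' := hsXyy
  rw [map_mul, map_pow] at hsXyy'
  simp only [map_mul, map_sub, map_one, map_pow, hsXyy'] at hst'
  -- the word `P Q P Q`, applied to `f` starting from the inside
  have hA : P (Q (P (Q f))) * ((1 - X) * (1 - y ^ 2) * (1 - X * y ^ 2) * (1 - (X * y) ^ 2)) =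
      (1 + β * (X * y)) * ((1 + β * y) * f - (y ^ 2 + β * y) * t f)
      - X * (1 + β * y) * ((1 + β * (X * y)) * s f - ((X * y) ^ 2 + β * (X * y)) * s (t f))
      + X * y ^ 2 * (y ^ 2 + β * y) *
        ((1 + β * (X * y)) * t (s f) - ((X * y) ^ 2 + β * (X * y)) * t (s (t f)))
      - X ^ 2 * y ^ 2 * ((X * y) ^ 2 + β * (X * y)) *
        ((1 + β * y) * s (t (s f)) - (y ^ 2 + β * y) * s (t (s (t f)))) := by
    have e1 := hQ (P (Q f))
    have e2 := hs (P (Q f))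
    have e3 := ht (Q f)
    have e4 := hst' (Q f)
    have e5 := hts f
    have e6 := congrArg s e5
    have hsXy' := hsXy
    rw [map_mul] at hsXy'
    simp only [map_mul, map_sub, map_add, map_one, map_pow, hsβ, hsXy'] at e6
    simp only [hsP, htQ] at e1 e2 e3 e4 e5 e6
    linear_combination (1 - y ^ 2) * (1 - X * y ^ 2) * (1 - (X * y) ^ 2) * hP (Q (P (Q f)))
      + (1 - X * y ^ 2) * (1 - (X * y) ^ 2) * e1 - X * (1 - y ^ 2) * (1 - X * y ^ 2) * e2
      + (1 - X * y ^ 2) * (1 + X * y ^ 2 + β * y + β * (X * y)) * hP (Q f)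
      - (1 - (X * y) ^ 2) * (y ^ 2 + β * y) * e3
      + X * (1 - y ^ 2) * ((X * y) ^ 2 + β * (X * y)) * e4
      + (1 + β * (X * y)) * hQ f - X * (1 + β * y) * hs f
      + X * y ^ 2 * (y ^ 2 + β * y) * e5
      - X ^ 2 * y ^ 2 * ((X * y) ^ 2 + β * (X * y)) * e6
  have hB : Q (P (Q (P f))) * ((1 - X) * (1 - y ^ 2) * (1 - X * y ^ 2) * (1 - (X * y) ^ 2)) =
      (1 + β * (X * y)) * (1 + β * y) * (f - X * s f)
      - (1 + β * (X * y)) * (y ^ 2 + β * y) * (t f - X * y ^ 2 * t (s f))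
      + X * (1 + β * y) * ((X * y) ^ 2 + β * (X * y)) * (s (t f) - X * y ^ 2 * s (t (s f)))
      - X * y ^ 2 * (y ^ 2 + β * y) * ((X * y) ^ 2 + β * (X * y)) *
        (t (s (t f)) - X * t (s (t (s f)))) := by
    have e1 := hP (Q (P f))
    have e2 := ht (Q (P f))
    have e3 := hs (P f)
    have e4 := hts (P f)
    have e5 := ht f
    have e6 := hst' f
    have e7 := congrArg t e6
    have htXyy' := htXyy
    rw [map_mul, map_pow] at htXyy'
    simp only [map_mul, map_sub, map_one, map_pow, htXyy'] at e7
    simp only [hsP, htQ] at e1 e2 e3 e4 e5 e6 e7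
    linear_combination (1 - X) * (1 - X * y ^ 2) * (1 - (X * y) ^ 2) * hQ (P (Q (P f)))
      + (1 - (X * y) ^ 2) * (1 + β * y) * (1 - X * y ^ 2) * e1
      - (1 - (X * y) ^ 2) * (y ^ 2 + β * y) * (1 - X) * e2
      + (1 - (X * y) ^ 2) * (1 + β * (X * y)) * hQ (P f)
      - X * (1 + β * y) * (1 - X * y ^ 2) * e3 + X * y ^ 2 * (y ^ 2 + β * y) * (1 - X) * e4
      + (1 + β * (X * y)) * (1 + β * y) * hP f
      - (1 + β * (X * y)) * (y ^ 2 + β * y) * e5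
      + X * (1 + β * y) * ((X * y) ^ 2 + β * (X * y)) * e6
      - X * y ^ 2 * (y ^ 2 + β * y) * ((X * y) ^ 2 + β * (X * y)) * e7
  linear_combination hA - hB
    + X ^ 2 * y ^ 2 * ((X * y) ^ 2 + β * (X * y)) * (y ^ 2 + β * y) * hst f

end Braid

/-- The three classical families of root systems. -/
inductive RootKind
  | A
  | BC
  | D

/-- The generators of the Weyl group. -/
def RootKind.Uses : RootKind → Generator n → Prop
  | _, .s _ _ _ => True
  | .BC, .neg _ _ => True
  | .D, .tau _ _ _ _ => True
  | _, _ => False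

namespace Generator

/-- The Cartan integers of two generators that span a root system of type `B_2`; `g'` is the
sign change `s_n`. -/
structure IsB2 (g g' : Generator n) : Prop where
  ht_half : g.ht g'.half = -1
  ht_root : g'.ht g.root = -1
  root_eq : g'.root = g'.half + g'.half

/-- The Cartan integers of two different generators. -/
theorem cartan_cases {κ : RootKind} {g g' : Generator n} (hg : κ.Uses g) (hg' : κ.Uses g')
    (hne : g ≠ g') :
    (g.ht g'.root = 0 ∧ g'.ht g.root = 0) ∨ (g.ht g'.root = -1 ∧ g'.ht g.root = -1) ∨
      IsB2 g g' ∨ IsB2 g' g := by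
  have hneg (i j : Fin n) (h) (k : Fin n) (h') :
      ((s i j h).ht (neg k h').root = 0 ∧ (neg k h').ht (s i j h).root = 0) ∨
        IsB2 (s i j h) (neg k h') := by
    rcases eq_or_ne j k with rfl | hjk
    · have := ne_of_succ_eq h
      exact .inr ⟨by simp [half, this], by simp [root, this.symm],
        by rw [half, root, ← Pi.single_add]; rfl⟩
    · have hik : i ≠ k := by rintro rfl; omega
      exact .inl ⟨by simp [root, hik, hjk], by simp [root, hik.symm, hjk.symm]⟩
  have htau (i j : Fin n) (h) (k l : Fin n) (h') (h'') :
      ((s i j h).ht (tau k l h' h'').root = 0 ∧ (tau k l h' h'').ht (s i j h).root = 0) ∨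
        ((s i j h).ht (tau k l h' h'').root = -1 ∧ (tau k l h' h'').ht (s i j h).root = -1) := by
    have hil : (i : ℕ) ≠ l := by omega
    simp only [ht_s, ht_tau, root, Pi.sub_apply, Pi.add_apply, Pi.single_apply, Fin.ext_iff]
    split_ifs <;> omega
  cases g with
  | s i j h =>
    cases g' with
    | s k l h' =>
      have hik : ¬ (i : ℕ) = k := by
        intro hik
        have e1 : i = k := Fin.ext hik
        have e2 : j = l := Fin.ext (by omega)
        subst e1 e2
        exact hne rfl
      have : ((s i j h).ht (s k l h').root = 0 ∧ (s k l h').ht (s i j h).root = 0) ∨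
          ((s i j h).ht (s k l h').root = -1 ∧ (s k l h').ht (s i j h).root = -1) := by
        simp only [ht_s, root, Pi.sub_apply, Pi.single_apply, Fin.ext_iff]
        split_ifs <;> omega
      tauto
    | neg k h' => have := hneg i j h k h'; tauto
    | tau k l h' h'' => have := htau i j h k l h' h''; tauto
  | neg i h =>
    cases g' with
    | s k l h' => have := hneg k l h' i h; tauto
    | neg k h' =>
      have e : i = k := Fin.ext (by omega)
      subst e
      exact absurd rfl hne
    | tau k l h' h'' => cases κ <;> simp [RootKind.Uses] at hg hg'
  | tau i j h h' =>
    cases g' with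
    | s k l h'' => have := htau k l h'' i j h h'; tauto
    | neg k h'' => cases κ <;> simp [RootKind.Uses] at hg hg'
    | tau k l h'' h''' =>
      have e1 : i = k := Fin.ext (by omega)
      have e2 : j = l := Fin.ext (by omega)
      subst e1 e2
      exact absurd rfl hne

theorem act_act_of_comm {g g' : Generator n} (h : g.ht g'.root = 0) (h' : g'.ht g.root = 0)
    (v : Fin n → ℤ) : g.act (g'.act v) = g'.act (g.act v) := by
  simp only [act_eq, map_sub, map_zsmul, h, h', smul_eq_mul]
  module

theorem act_act_of_A2 {g g' : Generator n} (h : g.ht g'.root = -1) (h' : g'.ht g.root = -1)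
    (v : Fin n → ℤ) : g.act (g'.act (g.act v)) = g'.act (g.act (g'.act v)) := by
  simp only [act_eq, map_sub, map_zsmul, ht_root, h, h', smul_eq_mul]
  module

theorem IsB2.ht_root' {g g' : Generator n} (h : IsB2 g g') : g.ht g'.root = -2 := by
  rw [h.root_eq, map_add, h.ht_half]; rfl

theorem act_act_of_B2 {g g' : Generator n} (h : IsB2 g g') (v : Fin n → ℤ) :
    g.act (g'.act (g.act (g'.act v))) = g'.act (g.act (g'.act (g.act v))) := by
  simp only [act_eq, map_sub, map_zsmul, ht_root, h.ht_root, h.ht_root', smul_eq_mul]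
  module

theorem bTerm_eq_zero_of_odd (β : R) {g : Generator n} (φ : (Fin n → ℤ) →+ ℤ)
    (h : φ g.root = -1) : (g.bTerm β : Laurent n R) = 0 := by
  rcases g.coef_eq_zero_or β with h0 | h0
  · simp [bTerm, h0]
  · rw [h0, map_add] at h; omega

theorem sub_bTerm_of_comm (β : R) {g g' : Generator n} (h : g.ht g'.root = 0) :
    g.sub (g'.bTerm β) = g'.bTerm β := by
  rcases g'.coef_eq_zero_or β with h0 | h0
  · simp [bTerm, h0]
  · rw [h0, map_add] at h
    rw [bTerm, map_smul, sub_mon, g.act_neg, g.act_of_ht_eq_zero (by omega)]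

/-- The substitution `f ↦ f^g` as a ring homomorphism. -/
def subHom (g : Generator n) : Laurent n R →+* Laurent n R := g.sub.toRingHom

@[simp] theorem subHom_apply (g : Generator n) (f : Laurent n R) : g.subHom f = g.sub f := rfl

theorem sub_sub_congr {g g' h h' : Generator n} (H : ∀ v, g.act (g'.act v) = h.act (h'.act v))
    (f : Laurent n R) : g.sub (g'.sub f) = h.sub (h'.sub f) := by
  refine linearMap_ext_mon (φ := g.sub.toLinearMap ∘ₗ g'.sub.toLinearMap)
    (ψ := h.sub.toLinearMap ∘ₗ h'.sub.toLinearMap) (fun w => ?_) f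
  simp [H]

end Generator

open Generator

theorem demazure_comm (β : R) {g g' : Generator n} (h : g.ht g'.root = 0)
    (h' : g'.ht g.root = 0) (f : Laurent n R) :
    demazure β g (demazure β g' f) = demazure β g' (demazure β g f) := by
  refine comm_of_mul_eq g.subHom g'.subHom (demazure_mul β g) (demazure_mul β g') ?_
    (sub_bTerm_of_comm β h') ?_ (sub_bTerm_of_comm β h) ?_
    (one_sub_root_mem g) (one_sub_root_mem g') f
  · simp [g'.act_neg, g'.act_of_ht_eq_zero h']
  · simp [g.act_neg, g.act_of_ht_eq_zero h]
  · exact sub_sub_congr (act_act_of_comm h h')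

theorem demazure_mul_of_bTerm_eq_zero {β : R} {g : Generator n}
    (h : (g.bTerm β : Laurent n R) = 0) (f : Laurent n R) :
    demazure β g f * (1 - mon (-g.root)) = f - mon (-g.root) * g.subHom f := by
  rw [demazure_mul, h, subHom_apply]; ring

theorem demazure_braid_A2 (β : R) {g g' : Generator n} (h : g.ht g'.root = -1)
    (h' : g'.ht g.root = -1) (f : Laurent n R) :
    demazure β g (demazure β g' (demazure β g f)) =
      demazure β g' (demazure β g (demazure β g' f)) := by
  have e1 : g.act g'.root = g.root + g'.root := by rw [g.act_eq, h]; module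
  have e2 : g'.act g.root = g.root + g'.root := by rw [g'.act_eq, h']; module
  have hsum : (mon (-g.root) * mon (-g'.root) : Laurent n R) = mon (-(g.root + g'.root)) := by
    rw [← mon_add]; congr 1; module
  refine braid_of_mul_eq_A2 g.subHom g'.subHom
    (demazure_mul_of_bTerm_eq_zero (bTerm_eq_zero_of_odd β _ h'))
    (demazure_mul_of_bTerm_eq_zero (bTerm_eq_zero_of_odd β _ h)) ?_ ?_ ?_ ?_
    (sub_demazure β g) (sub_demazure β g') (fun f => ?_)
    (mul_mem (mul_mem (one_sub_root_mem g) (one_sub_root_mem g')) ?_) f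
  · simp [g.act_neg, e1, hsum]
  · rw [hsum, ← e1]; simp [g.act_neg]
  · simp [g'.act_neg, e2, hsum]
  · rw [hsum, ← e2]; simp [g'.act_neg]
  · refine linearMap_ext_mon (φ := g.sub.toLinearMap ∘ₗ g'.sub.toLinearMap ∘ₗ g.sub.toLinearMap)
      (ψ := g'.sub.toLinearMap ∘ₗ g.sub.toLinearMap ∘ₗ g'.sub.toLinearMap) (fun w => ?_) f
    simp [act_act_of_A2 h h']
  · rw [hsum, ← e1, ← g.act_neg]
    refine one_sub_mon_mem_nonZeroDivisors fun h0 => g'.root_ne_zero ?_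
    have := congrArg g.act h0
    rw [g.act_act] at this
    simpa [g.act_eq] using this

theorem demazure_braid_B2 (β : R) {g g' : Generator n} (h : IsB2 g g') (f : Laurent n R) :
    demazure β g (demazure β g' (demazure β g (demazure β g' f))) =
      demazure β g' (demazure β g (demazure β g' (demazure β g f))) := by
  have hr := h.root_eq
  have e1 : g.act g'.half = g.root + g'.half := by rw [g.act_eq, h.ht_half]; module
  have e2 : g'.act g.root = g.root + g'.root := by rw [g'.act_eq, h.ht_root]; module
  have e3 : g'.act g'.half = -g'.half := by
    have := g'.ht_root
    rw [hr, map_add] at this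
    rw [g'.act_eq, show g'.ht g'.half = 1 by omega, hr]; module
  have e4 : g'.act (g.root + g'.half) = g.root + g'.half := by
    have := g'.actHom.map_add g.root g'.half
    simp only [actHom_apply] at this
    rw [this, e2, e3, hr]; module
  have e5 : g.act (g.root + g'.root) = g.root + g'.root := by
    refine g.act_of_ht_eq_zero ?_
    rw [map_add, g.ht_root, h.ht_root']; rfl
  have hsq : (mon (-g'.half) ^ 2 : Laurent n R) = mon (-g'.root) := by
    rw [sq, ← mon_add, hr]; congr 1; module
  have hz : (mon (-g.root) * mon (-g'.half) : Laurent n R) = mon (-(g.root + g'.half)) := by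
    rw [← mon_add]; congr 1; module
  have hw : (mon (-g.root) * mon (-g'.root) : Laurent n R) = mon (-(g.root + g'.root)) := by
    rw [← mon_add]; congr 1; module
  have hne {a : Fin n → ℤ} (ha : g.ht a ≠ 0 ∨ g'.ht a ≠ 0) :
      (1 - mon (-a) : Laurent n R) ∈ nonZeroDivisors (Laurent n R) := by
    refine one_sub_mon_mem_nonZeroDivisors fun h0 => ?_
    rw [neg_eq_zero] at h0
    simp [h0] at ha
  refine braid_of_mul_eq_B2 g.subHom g'.subHom (X := mon (-g.root)) (y := mon (-g'.half))
    (β := const (g'.coef β))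
    (demazure_mul_of_bTerm_eq_zero (bTerm_eq_zero_of_odd β _ h.ht_root)) (fun f => ?_)
    ?_ ?_ ?_ ?_ ?_ ?_ ?_ ?_ (sub_demazure β g) (sub_demazure β g') (fun f => ?_) ?_ f
  · rw [hsq, demazure_mul, bTerm, const_mul]; rfl
  · simp [g.act_neg, e1, hz]
  · rw [hz, ← e1]; simp [g.act_neg]
  · rw [hsq, hw]; simp [g'.act_neg, e2]
  · rw [hz, subHom_apply, sub_mon, g'.act_neg, e4]
  · rw [hsq, hw, ← e2]; simp [g'.act_neg]
  · rw [hsq, hw, subHom_apply, sub_mon, g.act_neg, e5]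
  · rw [← mul_one (const _), const_mul, subHom_apply, map_smul, map_one]
  · rw [← mul_one (const _), const_mul, subHom_apply, map_smul, map_one]
  · refine linearMap_ext_mon
      (φ := g.sub.toLinearMap ∘ₗ g'.sub.toLinearMap ∘ₗ g.sub.toLinearMap ∘ₗ g'.sub.toLinearMap)
      (ψ := g'.sub.toLinearMap ∘ₗ g.sub.toLinearMap ∘ₗ g'.sub.toLinearMap ∘ₗ g.sub.toLinearMap)
      (fun w => ?_) f
    simp [act_act_of_B2 h]
  · rw [hz, hsq, hw, show (mon (-(g.root + g'.half)) ^ 2 : Laurent n R)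
      = mon (-(g.root + g'.half + (g.root + g'.half))) by rw [sq, ← mon_add]; congr 1; module]
    refine mul_mem (mul_mem (mul_mem (hne ?_) (hne ?_)) (hne ?_)) (hne ?_)
    · simp
    · simp
    · right; rw [map_add, h.ht_root, g'.ht_root]; decide
    · left; simp only [map_add, h.ht_half, g.ht_root]; decide

open Generator

/-! ### Products over pairs and adjacent transpositions -/

/-- The pairs `p < q` other than `(i, j)`. -/
def pairsExcept (i j : Fin n) : Finset (Fin n × Fin n) :=
  Finset.univ.filter fun p => p.1 < p.2 ∧ p ≠ (i, j)

@[to_additive]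
theorem prod_pairs_eq_mul {M : Type*} [CommMonoid M] (Φ : Fin n → Fin n → M) {i j : Fin n}
    (h : (i : ℕ) + 1 = j) :
    ∏ p, ∏ q ∈ Finset.Ioi p, Φ p q = Φ i j * ∏ p ∈ pairsExcept i j, Φ p.1 p.2 := by
  have h1 := Finset.prod_finset_product (Finset.univ.filter fun p : Fin n × Fin n => p.1 < p.2)
    Finset.univ (fun p => Finset.Ioi p) (by simp) (f := fun p => Φ p.1 p.2)
  have h2 : (Finset.univ.filter fun p : Fin n × Fin n => p.1 < p.2) =
      insert (i, j) (pairsExcept i j) := by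
    ext ⟨p, q⟩
    have : i < j := Fin.lt_def.mpr (by omega)
    by_cases hpq : (p, q) = (i, j)
    · simp_all [pairsExcept]
    · simp [pairsExcept, hpq]
  rw [← h1, h2, Finset.prod_insert (by simp [pairsExcept])]

/-- The simple reflection `s_i` permutes the positive roots other than its own. -/
@[to_additive]
theorem prod_pairsExcept_swap {M : Type*} [CommMonoid M] (Φ : Fin n → Fin n → M) {i j : Fin n}
    (h : (i : ℕ) + 1 = j) :
    ∏ p ∈ pairsExcept i j, Φ (Equiv.swap i j p.1) (Equiv.swap i j p.2) =
      ∏ p ∈ pairsExcept i j, Φ p.1 p.2 := by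
  refine Finset.prod_equiv ((Equiv.swap i j).prodCongr (Equiv.swap i j)) ?_ (fun _ _ => rfl)
  rintro ⟨p, q⟩
  simp only [pairsExcept, Finset.mem_filter, Finset.mem_univ, true_and, Equiv.prodCongr_apply,
    Prod.map_apply, Equiv.swap_apply_def, Fin.lt_def, ne_eq, Prod.mk.injEq, Fin.ext_iff]
  split_ifs <;> omega

/-! ### The length function -/

namespace RootKind

/-- The number of positive roots in the plane of two coordinates that are negative on `(a, b)`. -/
def pairLength : RootKind → ℤ → ℤ → ℕ
  | .A, a, b => if a < b then 1 else 0
  | _, a, b => (if a < b then 1 else 0) + if a + b < 0 then 1 else 0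

/-- The number of positive roots on the line of one coordinate that are negative on `a`. -/
def oneLength : RootKind → ℤ → ℕ
  | .BC, a => if a < 0 then 1 else 0
  | _, _ => 0

/-- The number of positive roots that are negative on `v`. -/
def length (κ : RootKind) (v : Fin n → ℤ) : ℕ :=
  ∑ p, ∑ q ∈ Finset.Ioi p, κ.pairLength (v p) (v q) + ∑ p, κ.oneLength (v p)

theorem act_s_apply {i j : Fin n} (h : (i : ℕ) + 1 = j) (v : Fin n → ℤ) (p : Fin n) :
    (Generator.s i j h).act v p = v (Equiv.swap i j p) := by
  have := ne_of_succ_eq h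
  rw [Generator.act, Equiv.swap_apply_def]
  rcases eq_or_ne p j with rfl | hj
  · simp [this.symm]
  · rcases eq_or_ne p i with rfl | hi <;> simp [*]

theorem length_act_s (κ : RootKind) {i j : Fin n} (h : (i : ℕ) + 1 = j) {v : Fin n → ℤ}
    (hv : v j < v i) : κ.length ((Generator.s i j h).act v) = κ.length v + 1 := by
  unfold length
  rw [sum_pairs_eq_add _ h, sum_pairs_eq_add _ h]
  simp only [act_s_apply, Equiv.swap_apply_left, Equiv.swap_apply_right]
  rw [sum_pairsExcept_swap (fun p q => κ.pairLength (v p) (v q)) h,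
    Equiv.sum_comp (Equiv.swap i j) fun p => κ.oneLength (v p)]
  have : κ.pairLength (v j) (v i) = κ.pairLength (v i) (v j) + 1 := by
    cases κ <;> simp only [pairLength] <;> split_ifs <;> omega
  omega

/-- The sign change of the last coordinate permutes the roots `± e_p ± e_q` that are positive. -/
theorem sum_pairLength_neg {κ : RootKind} (hκ : κ ≠ .A) {i : Fin n} (h : (i : ℕ) + 1 = n)
    (v : Fin n → ℤ) :
    ∑ p, ∑ q ∈ Finset.Ioi p, κ.pairLength ((Generator.neg i h).act v p)
      ((Generator.neg i h).act v q) = ∑ p, ∑ q ∈ Finset.Ioi p, κ.pairLength (v p) (v q) := by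
  refine Finset.sum_congr rfl fun p _ => Finset.sum_congr rfl fun q hq => ?_
  rw [Finset.mem_Ioi, Fin.lt_def] at hq
  have hp : p ≠ i := by rintro rfl; omega
  rcases eq_or_ne q i with rfl | hqi
  · cases κ with
    | A => exact absurd rfl hκ
    | _ =>
      simp only [Generator.act, Function.update_self, Function.update_of_ne hp, pairLength]
      split_ifs <;> omega
  · simp [Generator.act, hp, hqi]

theorem act_tau_eq {i j : Fin n} (h : (i : ℕ) + 2 = n) (h' : (j : ℕ) + 1 = n)
    (hij : (i : ℕ) + 1 = j) (v : Fin n → ℤ) :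
    (Generator.tau i j h h').act v =
      (Generator.neg j h').act ((Generator.s i j hij).act ((Generator.neg j h').act v)) := by
  have := ne_of_succ_eq hij
  ext p
  simp only [Generator.act]
  rcases eq_or_ne p j with rfl | hj
  · simp [this]
  · rcases eq_or_ne p i with rfl | hi <;> simp [*]

theorem length_act {κ : RootKind} {g : Generator n} (hg : κ.Uses g) {v : Fin n → ℤ}
    (hv : 0 < g.ht v) : κ.length (g.act v) = κ.length v + 1 := by
  cases g with
  | s i j h => exact κ.length_act_s h (by simpa using hv)
  | neg i h =>
    cases κ with
    | A => exact hg.elim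
    | D => exact hg.elim
    | BC =>
      rw [ht_neg] at hv
      unfold length
      have hact (p : Fin n) (hp : p ≠ i) : (Generator.neg i h).act v p = v p := by
        simp [Generator.act, hp]
      have hact' : (Generator.neg i h).act v i = -v i := by simp [Generator.act]
      have herase : ∑ p ∈ Finset.univ.erase i, RootKind.BC.oneLength ((Generator.neg i h).act v p) =
          ∑ p ∈ Finset.univ.erase i, RootKind.BC.oneLength (v p) :=
        Finset.sum_congr rfl fun p hp => by rw [hact p (Finset.ne_of_mem_erase hp)]
      rw [sum_pairLength_neg (by simp) h,
        ← Finset.add_sum_erase _ (fun p => RootKind.BC.oneLength (v p)) (Finset.mem_univ i),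
        ← Finset.add_sum_erase _ (fun p => RootKind.BC.oneLength ((Generator.neg i h).act v p))
          (Finset.mem_univ i), herase]
      have h1 : RootKind.BC.oneLength (-v i) = 1 := if_pos (by omega)
      have h2 : RootKind.BC.oneLength (v i) = 0 := if_neg (by omega)
      rw [hact', h1, h2]
      omega
  | tau i j h h' =>
    cases κ with
    | A => exact hg.elim
    | BC => exact hg.elim
    | D =>
      have hij : (i : ℕ) + 1 = j := by omega
      have hneg (w : Fin n → ℤ) : RootKind.D.length ((Generator.neg j h').act w) =
          RootKind.D.length w := by
        unfold length
        rw [sum_pairLength_neg (by simp) h']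
        rfl
      rw [act_tau_eq h h' hij, hneg, length_act_s, hneg]
      rw [ht_tau] at hv
      simp only [Generator.act, Function.update_self, Function.update_of_ne (ne_of_succ_eq hij)]
      omega

theorem length_neg_act {κ : RootKind} {g : Generator n} (hg : κ.Uses g) {v : Fin n → ℤ}
    (hv : 0 < g.ht v) : κ.length (-v) = κ.length (-g.act v) + 1 := by
  rw [← length_act hg (by rwa [map_neg, ht_act, neg_neg]), g.act_neg, g.act_act]

/-- The dominant vectors: those on the nonnegative side of all mirrors of generators. -/
def Dominant (κ : RootKind) (v : Fin n → ℤ) : Prop := ∀ g : Generator n, κ.Uses g → 0 ≤ g.ht v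

theorem antitone_of_succ_le {v : Fin n → ℤ} (h : ∀ i j : Fin n, (i : ℕ) + 1 = j → v j ≤ v i) :
    Antitone v := by
  intro i j hij
  obtain ⟨k, hk⟩ := Nat.exists_eq_add_of_le (Fin.le_def.mp hij)
  induction k generalizing j with
  | zero => rw [show j = i from Fin.ext hk]
  | succ k ih =>
    have hlt : (i : ℕ) + k < n := by omega
    exact (h ⟨i + k, hlt⟩ j (by simp [hk, add_assoc])).trans (ih (Fin.le_def.mpr (by simp)) rfl)

theorem Dominant.antitone {κ : RootKind} {v : Fin n → ℤ} (h : κ.Dominant v) : Antitone v :=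
  antitone_of_succ_le fun i j hij => by
    have := h (.s i j hij) (by cases κ <;> trivial)
    rw [ht_s] at this; omega

theorem Dominant.nonneg {v : Fin n → ℤ} (h : RootKind.BC.Dominant v) (i : Fin n) : 0 ≤ v i := by
  have hlt : n - 1 < n := by have := i.2; omega
  have h1 := h (.neg ⟨n - 1, hlt⟩ (by simp only []; omega)) trivial
  have h2 := h.antitone (show i ≤ ⟨n - 1, hlt⟩ from Fin.le_def.mpr (by simp only []; omega))
  rw [ht_neg] at h1
  exact h1.trans h2

theorem Dominant.add_nonneg {v : Fin n → ℤ} (h : RootKind.D.Dominant v) {i j : Fin n}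
    (hij : i < j) : 0 ≤ v i + v j := by
  have hij := Fin.lt_def.mp hij
  have hlt : n - 1 < n := by omega
  have hlt' : n - 2 < n := by omega
  have h1 := h (.tau ⟨n - 2, hlt'⟩ ⟨n - 1, hlt⟩ (by simp only []; omega) (by simp only []; omega))
    trivial
  have h2 := h.antitone (show j ≤ ⟨n - 1, hlt⟩ from Fin.le_def.mpr (by simp only []; omega))
  have h3 := h.antitone (show i ≤ ⟨n - 2, hlt'⟩ from Fin.le_def.mpr (by simp only []; omega))
  rw [ht_tau] at h1
  omega

theorem Dominant.length_eq_zero {κ : RootKind} {v : Fin n → ℤ} (h : κ.Dominant v) :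
    κ.length v = 0 := by
  have h1 (p : Fin n) : κ.oneLength (v p) = 0 := by
    cases κ with
    | BC => exact if_neg (not_lt.mpr (h.nonneg p))
    | _ => rfl
  have h2 (p q : Fin n) (hq : p < q) : κ.pairLength (v p) (v q) = 0 := by
    have h2 := h.antitone hq.le
    cases κ with
    | A => exact if_neg (not_lt.mpr h2)
    | BC =>
      have := h.nonneg p
      have := h.nonneg q
      rw [pairLength, if_neg (by omega), if_neg (by omega)]
      exact RootKind.noConfusion
    | D =>
      have := h.add_nonneg hq
      rw [pairLength, if_neg (by omega), if_neg (by omega)]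
      exact RootKind.noConfusion
  rw [length, Finset.sum_eq_zero fun p _ => Finset.sum_eq_zero fun q hq =>
    h2 p q (Finset.mem_Ioi.mp hq), Finset.sum_eq_zero fun p _ => h1 p, add_zero]

end RootKind

/-! ### Key polynomials -/

/-- The recursion of the key polynomials, started from all dominant vectors (not only the
partitions), and with the ascent condition expressed by coroots. -/
inductive GenKey (κ : RootKind) (op : Generator n → Laurent n R → Laurent n R) :
    (Fin n → ℤ) → Laurent n R → Prop
  | base (v : Fin n → ℤ) (h : κ.Dominant v) : GenKey κ op v (mon v)
  | step (g : Generator n) (v : Fin n → ℤ) (f : Laurent n R) (hg : κ.Uses g) (hv : 0 < g.ht v)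
      (hf : GenKey κ op v f) : GenKey κ op (g.act v) (op g f)

/-- The exponents of `K_v` lie in the ball of radius `|v|`. On its boundary, `v` is the only exponent
among those that are not above `v` in length; `-u` is used as `length (-u)` is zero for the
antidominant vectors `u`. -/
theorem GenKey.coeff_eq {κ : RootKind} {β : R} {v : Fin n → ℤ} {f : Laurent n R}
    (h : GenKey κ (fun g => demazure β g) v f) :
    (∀ w, f.coeff w ≠ 0 → normSq w ≤ normSq v) ∧
      ∀ u, normSq u = normSq v → κ.length (-u) ≤ κ.length (-v) →
        f.coeff u = if u = v then 1 else 0 := by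
  induction h with
  | base v hv =>
    refine ⟨fun w hw => ?_, fun u _ _ => by simp only [coeff_mon, eq_comm]⟩
    rw [coeff_mon] at hw
    split_ifs at hw with h
    · rw [h]
    · exact absurd rfl hw
  | step g v f hg hv hf ih =>
    refine ⟨fun w hw => ?_, fun u hu hl => ?_⟩
    · rw [normSq_act]
      exact normSq_le_of_coeff_demazure_ne_zero β g ih.1 w hw
    · rw [normSq_act] at hu
      rw [coeff_demazure β g fun w hw => (ih.1 w hw).trans hu.ge]
      have hl' := RootKind.length_neg_act hg hv
      rw [ih.2 _ (by rw [normSq_fold, hu])]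
      · unfold Generator.fold
        by_cases h1 : g.ht u < 0
        · have : g.act u = v ↔ u = g.act v :=
            ⟨fun h => by rw [← h, g.act_act], fun h => by rw [h, g.act_act]⟩
          simp only [if_pos h1, this]
        · rw [if_neg h1, if_neg, if_neg]
          · rintro rfl
            rw [ht_act] at h1
            omega
          · rintro rfl
            omega
      · unfold Generator.fold
        split_ifs with h1
        · rw [← g.act_neg, RootKind.length_act hg (by rw [map_neg]; omega)]
          omega
        · omega

/-- Every descent of `v` is the last step of a recursion for `K_v`, and `K_v` is fixed by `π_g` if
`v` lies on the mirror of `g`. Both are shown together, by following the recursion back through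
the orbit of `v` under the two generators involved, where the braid relations apply. -/
theorem GenKey.descent {κ : RootKind} {β : R} {v : Fin n → ℤ} {f : Laurent n R}
    (h : GenKey κ (fun g => demazure β g) v f) {g : Generator n} (hg : κ.Uses g) :
    (g.ht v < 0 → ∃ f', GenKey κ (fun g => demazure β g) (g.act v) f' ∧ f = demazure β g f') ∧
      (g.ht v = 0 → demazure β g f = f) := by
  induction hN : κ.length v using Nat.strong_induction_on generalizing v f g with
  | _ N IH =>
  subst hN
  cases h with
  | base _ hv =>
    refine ⟨fun h0 => absurd (hv g hg) (not_le.mpr h0), fun h0 => ?_⟩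
    exact demazure_of_sub_eq β g (by rw [sub_mon, g.act_of_ht_eq_zero h0])
  | step g' v₁ f₁ hg' ha hf₁ =>
  have hlt₁ : κ.length v₁ < κ.length (g'.act v₁) := by rw [RootKind.length_act hg' ha]; omega
  by_cases hgg : g = g'
  · subst hgg
    rw [ht_act, g.act_act]
    exact ⟨fun _ => ⟨f₁, hf₁, rfl⟩, fun h0 => by omega⟩
  have hht (x y : Generator n) (w : Fin n → ℤ) : x.ht (y.act w) = x.ht w - y.ht w * x.ht y.root := by
    rw [y.act_eq, map_sub, map_zsmul, smul_eq_mul]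
  have IH₁ := IH _ hlt₁ hf₁ hg rfl
  -- the argument for type `B_2`, which is needed for both orders of the two generators
  have hB2 (hc : g.ht g'.root * g'.ht g.root = 2) (hc1 : g.ht g'.root < 0)
      (hc2 : g'.ht g.root < 0)
      (hact : ∀ w, g'.act (g.act (g'.act (g.act w))) = g.act (g'.act (g.act (g'.act w))))
      (hbr : ∀ f, demazure β g' (demazure β g (demazure β g' (demazure β g f))) =
        demazure β g (demazure β g' (demazure β g (demazure β g' f)))) :
      (g.ht (g'.act v₁) < 0 → ∃ f', GenKey κ (fun g => demazure β g) (g.act (g'.act v₁)) f' ∧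
        demazure β g' f₁ = demazure β g f') ∧
      (g.ht (g'.act v₁) = 0 → demazure β g (demazure β g' f₁) = demazure β g' f₁) := by
    suffices H : g.ht (g'.act v₁) ≤ 0 → ∃ v₃ f₃, κ.length v₃ < κ.length (g'.act v₁) ∧
        GenKey κ (fun g => demazure β g) v₃ f₃ ∧ v₃ = g'.act (g.act v₁) ∧
        f₁ = demazure β g (demazure β g' f₃) ∧ g.ht v₃ = g.ht (g'.act v₁) ∧
        g'.ht v₃ = g'.ht v₁ + g.ht (g'.act v₁) * g'.ht g.root by
      refine ⟨fun h0 => ?_, fun h0 => ?_⟩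
      · obtain ⟨v₃, f₃, hl₃, hf₃, hv₃, hf, ht₃, ht₃'⟩ := H h0.le
        obtain ⟨e, he, rfl⟩ := (IH _ hl₃ hf₃ hg rfl).1 (ht₃.trans_lt h0)
        refine ⟨_, ?_, by rw [hf, hbr]⟩
        have k1 : g'.ht (g.act v₃) = g'.ht v₁ := by rw [hht, ht₃, ht₃']; ring
        have k2 : g.ht (g'.act (g.act v₃)) = - g.ht v₁ := by
          rw [hht, k1, ht_act, ht₃, hht]; ring
        have k3 : g'.ht (g.act (g'.act (g.act v₃))) = g'.ht v₁ + g.ht (g'.act v₁) * g'.ht g.root := by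
          rw [hht, ht_act, k1, k2, hht g g']
          linear_combination g'.ht v₁ * hc
        have p1 : 0 < g.ht (g'.act (g.act v₃)) := by
          rw [k2]; rw [hht] at h0; nlinarith
        have p2 : 0 < g'.ht (g.act (g'.act (g.act v₃))) := by rw [k3]; nlinarith
        have := GenKey.step g' _ _ hg' p2 (.step g _ _ hg p1 (.step g' _ _ hg' (k1 ▸ ha) he))
        rwa [hact, hv₃, g'.act_act, g.act_act] at this
      · obtain ⟨v₃, f₃, hl₃, hf₃, hv₃, hf, ht₃, ht₃'⟩ := H h0.le
        have h3 := (IH _ hl₃ hf₃ hg rfl).2 (ht₃.trans h0)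
        rw [hf, ← hbr, h3]
    intro h0
    have k1 : g.ht v₁ < 0 := by rw [hht] at h0; nlinarith
    obtain ⟨f₂, hf₂, rfl⟩ := IH₁.1 k1
    have k2 : g'.ht (g.act v₁) = -(g'.ht v₁ + g.ht (g'.act v₁) * g'.ht g.root) := by
      rw [hht, hht g g']; linear_combination -g'.ht v₁ * hc
    have k3 : g'.ht (g.act v₁) < 0 := by rw [k2]; nlinarith
    have hl₂ : κ.length v₁ = κ.length (g.act v₁) + 1 := by
      rw [← RootKind.length_act hg (by rw [ht_act]; omega), g.act_act]
    have hl₃ : κ.length (g.act v₁) = κ.length (g'.act (g.act v₁)) + 1 := by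
      rw [← RootKind.length_act hg' (by rw [ht_act]; omega), g'.act_act]
    obtain ⟨f₃, hf₃, rfl⟩ := (IH _ (by omega) hf₂ hg' rfl).1 k3
    refine ⟨_, f₃, by omega, hf₃, rfl, rfl, ?_, by rw [ht_act, k2, neg_neg]⟩
    rw [hht, k2, ht_act, hht g g']
    linear_combination (g.ht v₁ - g'.ht v₁ * g.ht g'.root) * hc
  -- the cases of the product `A_1 × A_1`, of `A_2`, and of `B_2` in either order
  rcases cartan_cases hg hg' hgg with ⟨hc, hc'⟩ | ⟨hc, hc'⟩ | hB | hB
  · rw [hht, hc, mul_zero, sub_zero]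
    refine ⟨fun h0 => ?_, fun h0 => by rw [demazure_comm β hc hc', IH₁.2 h0]⟩
    obtain ⟨e, he, rfl⟩ := IH₁.1 h0
    refine ⟨_, ?_, demazure_comm β hc' hc e⟩
    rw [act_act_of_comm hc hc']
    exact .step g' _ _ hg' (by rw [hht, hc']; omega) he
  · suffices H : g.ht (g'.act v₁) ≤ 0 → ∃ f₂, κ.length (g.act v₁) < κ.length (g'.act v₁) ∧
        GenKey κ (fun g => demazure β g) (g.act v₁) f₂ ∧ f₁ = demazure β g f₂ by
      have k2 : g'.ht (g.act v₁) = g.ht (g'.act v₁) := by rw [hht, hht, hc, hc']; ring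
      have k3 := hht g g' v₁
      refine ⟨fun h0 => ?_, fun h0 => ?_⟩
      · obtain ⟨f₂, hl₂, hf₂, rfl⟩ := H h0.le
        obtain ⟨e, he, rfl⟩ := (IH _ hl₂ hf₂ hg' rfl).1 (by omega)
        refine ⟨_, ?_, demazure_braid_A2 β hc' hc e⟩
        have p1 : g.ht (g'.act (g.act v₁)) = g'.ht v₁ := by rw [hht, k2, ht_act, k3, hc]; ring
        have p2 : 0 < g'.ht (g.act (g'.act (g.act v₁))) := by
          rw [hht, p1, ht_act, k2, hc']; omega
        have := GenKey.step g' _ _ hg' p2 (.step g _ _ hg (p1 ▸ ha) he)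
        rwa [act_act_of_A2 hc' hc, g.act_act] at this
      · obtain ⟨f₂, hl₂, hf₂, rfl⟩ := H h0.le
        have h3 := (IH _ hl₂ hf₂ hg' rfl).2 (by omega)
        rw [← h3, demazure_braid_A2 β hc' hc, demazure_demazure]
    intro h0
    rw [hht, hc] at h0
    obtain ⟨f₂, hf₂, rfl⟩ := IH₁.1 (by omega)
    have hl₂ : κ.length v₁ = κ.length (g.act v₁) + 1 := by
      rw [← RootKind.length_act hg (by rw [ht_act]; omega), g.act_act]
    exact ⟨f₂, by omega, hf₂, rfl⟩
  · exact hB2 (by rw [hB.ht_root, hB.ht_root']; rfl) (by rw [hB.ht_root']; decide)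
      (by rw [hB.ht_root]; decide) (fun w => (act_act_of_B2 hB w).symm)
      (fun f => (demazure_braid_B2 β hB f).symm)
  · exact hB2 (by rw [hB.ht_root, hB.ht_root']; rfl) (by rw [hB.ht_root]; decide)
      (by rw [hB.ht_root']; decide) (fun w => act_act_of_B2 hB w)
      (fun f => demazure_braid_B2 β hB f)

theorem GenKey.demazure_eq_self {κ : RootKind} {β : R} {v : Fin n → ℤ} {f : Laurent n R}
    (h : GenKey κ (fun g => demazure β g) v f) {g : Generator n} (hg : κ.Uses g)
    (hv : g.ht v ≤ 0) : demazure β g f = f := by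
  rcases hv.lt_or_eq with h0 | h0
  · obtain ⟨f', -, rfl⟩ := (h.descent hg).1 h0
    exact demazure_demazure β g f'
  · exact (h.descent hg).2 h0

/-! ### The constant term twisted by the series `∏ (1 + β x_i)⁻¹` -/

/-- The coefficient of `x^m` in `(1 + β x)⁻¹`. -/
def invCoeff (β : R) (m : ℤ) : R := if 0 ≤ m then (-β) ^ m.toNat else 0

theorem invCoeff_add (β : R) (m : ℤ) :
    invCoeff β m + β * invCoeff β (m - 1) = if m = 0 then 1 else 0 := by
  unfold invCoeff
  rcases lt_trichotomy m 0 with h | rfl | h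
  · rw [if_neg (by omega), if_neg (by omega), if_neg (by omega)]; ring
  · simp
  · obtain ⟨k, hk⟩ := Int.eq_ofNat_of_zero_le (show 0 ≤ m - 1 by omega)
    rw [if_pos (by omega), if_pos (by omega), if_neg (by omega), hk, Int.toNat_natCast,
      show m.toNat = k + 1 by omega, pow_succ]
    ring

/-- The linear form `F ↦ CT (F ∏ (1 + β x_i)⁻¹)`. -/
def seriesCT (β : R) : Laurent n R →ₗ[R] R := extend fun e => invSeries β (-e)

theorem seriesCT_mon (β : R) (e : Fin n → ℤ) :
    seriesCT β (mon e) = ∏ i, invCoeff β (-e i) := extend_mon _ e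

theorem seriesCT_eq_mulSeries (β : R) (f : Laurent n R) :
    seriesCT β f = mulSeries f (invSeries β) 0 := by
  simp only [seriesCT, extend_apply, mulSeries, zero_sub, smul_eq_mul]

/-- The constant term as a linear form. -/
def ctHom : Laurent n R →ₗ[R] R := Finsupp.lapply 0 ∘ₗ (coeffLinearEquiv R).toLinearMap

theorem ctHom_apply (f : Laurent n R) : ctHom f = CT f := rfl

theorem CT_mon (e : Fin n → ℤ) : CT (mon e : Laurent n R) = if e = 0 then 1 else 0 :=
  coeff_mon e 0

theorem prod_ite_eq_zero (e : Fin n → ℤ) :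
    (∏ i, if e i = 0 then (1 : R) else 0) = if e = 0 then 1 else 0 := by
  split_ifs with h
  · simp [h]
  · obtain ⟨i, hi⟩ := Function.ne_iff.mp h
    exact Finset.prod_eq_zero (Finset.mem_univ i) (if_neg hi)

theorem seriesCT_zero (f : Laurent n R) : seriesCT 0 f = CT f := by
  rw [← ctHom_apply]
  refine linearMap_ext_mon (fun e => ?_) f
  rw [seriesCT_mon, ctHom_apply, CT_mon, ← prod_ite_eq_zero]
  refine Finset.prod_congr rfl fun i _ => ?_
  have := invCoeff_add (0 : R) (-e i)
  rw [zero_mul, add_zero] at this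
  rw [this]
  simp only [neg_eq_zero]

/-- Multiplication with `∏ (1 + x_i)` undoes the series with `β = 1`. -/
theorem seriesCT_one_mul (f : Laurent n R) : seriesCT 1 ((∏ i, (1 + x i)) * f) = CT f := by
  rw [← ctHom_apply]
  refine linearMap_ext_mon (φ := seriesCT 1 ∘ₗ LinearMap.mulLeft R (∏ i, (1 + x i)))
    (fun e => ?_) f
  rw [LinearMap.comp_apply, LinearMap.mulLeft_apply, ctHom_apply, CT_mon, Finset.prod_one_add,
    Finset.sum_mul, map_sum, ← prod_ite_eq_zero]
  have hterm (T : Finset (Fin n)) : seriesCT (1 : R) ((∏ i ∈ T, x i) * mon e) =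
      ∏ i, invCoeff (1 : R) (-e i - if i ∈ T then 1 else 0) := by
    simp only [x]
    rw [prod_mon, ← mon_add, seriesCT_mon]
    refine Finset.prod_congr rfl fun i _ => ?_
    congr 1
    rw [Pi.add_apply, Finset.sum_apply]
    simp only [Pi.single_apply, Finset.sum_ite_eq]
    ring
  simp only [hterm]
  have hsplit := Finset.prod_add (fun i => invCoeff (1 : R) (-e i - 1))
    (fun i => invCoeff (1 : R) (-e i)) Finset.univ
  rw [Finset.prod_congr rfl fun i _ => show (if e i = 0 then (1 : R) else 0) =
    invCoeff (1 : R) (-e i - 1) + invCoeff (1 : R) (-e i) by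
      rw [add_comm, ← one_mul (invCoeff (1 : R) (-e i - 1)), invCoeff_add]
      simp only [neg_eq_zero], hsplit]
  refine Finset.sum_congr rfl fun T _ => ?_
  rw [← Finset.prod_sdiff (Finset.subset_univ T), mul_comm]
  congr 1
  · exact Finset.prod_congr rfl fun i hi => by rw [if_pos hi]
  · exact Finset.prod_congr rfl fun i hi => by
      rw [if_neg (Finset.mem_sdiff.mp hi).2, sub_zero]

/-- The reflection formula for the twisted constant term, from which the self-adjointness of the
operators `π_g` follows. -/
theorem seriesCT_sub {κ : RootKind} {β : R} (hβ : κ = .BC ∨ β = 0) {g : Generator n}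
    (hg : κ.Uses g) (f : Laurent n R) :
    seriesCT β ((1 + g.bTerm β * mon g.root) * g.sub f) =
      seriesCT β ((1 + g.bTerm β * mon g.root) * f) := by
  refine linearMap_ext_mon
    (φ := seriesCT β ∘ₗ LinearMap.mulLeft R (1 + g.bTerm β * mon g.root) ∘ₗ g.sub.toLinearMap)
    (ψ := seriesCT β ∘ₗ LinearMap.mulLeft R (1 + g.bTerm β * mon g.root)) (fun w => ?_) f
  simp only [LinearMap.comp_apply, LinearMap.mulLeft_apply, AlgHom.toLinearMap_apply, sub_mon]
  cases g with
  | s i j h =>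
    have hb : (Generator.s i j h).bTerm β = (0 : Laurent n R) := by simp [bTerm, coef]
    rw [hb, zero_mul, add_zero, one_mul, one_mul, seriesCT_mon, seriesCT_mon]
    simp only [RootKind.act_s_apply]
    exact Equiv.prod_comp (Equiv.swap i j) fun p => invCoeff β (-w p)
  | neg i h =>
    have hb : (Generator.neg i h).bTerm β * mon (Generator.neg i h).root =
        const β * (x i : Laurent n R) := by
      rw [bTerm, coef, ← const_mul, mul_assoc, ← mon_add, x, half, root]
      congr 2
      rw [← Pi.single_neg, ← Pi.single_add]; rfl
    have key (w : Fin n → ℤ) : seriesCT β ((1 + const β * x i) * mon w) =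
        (if w i = 0 then 1 else 0) * ∏ p ∈ Finset.univ.erase i, invCoeff β (-w p) := by
      have hsplit (e : Fin n → ℤ) : seriesCT β (mon e) =
          invCoeff β (-e i) * ∏ p ∈ Finset.univ.erase i, invCoeff β (-e p) := by
        rw [seriesCT_mon, Finset.mul_prod_erase _ (fun p => invCoeff β (-e p)) (Finset.mem_univ i)]
      rw [add_mul, one_mul, mul_assoc, const_mul, map_add, map_smul, x, ← mon_add, hsplit, hsplit]
      have h1 : ∏ p ∈ Finset.univ.erase i, invCoeff β (-(Pi.single i 1 + w : Fin n → ℤ) p) =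
          ∏ p ∈ Finset.univ.erase i, invCoeff β (-w p) :=
        Finset.prod_congr rfl fun p hp => by simp [Finset.ne_of_mem_erase hp]
      have h2 := invCoeff_add β (-w i)
      simp only [neg_eq_zero] at h2
      rw [h1, ← h2, smul_eq_mul, Pi.add_apply, Pi.single_eq_same,
        show -(1 + w i) = -w i - 1 by ring]
      ring
    rw [hb, key, key, show (Generator.neg i h).act w i = -w i by simp [Generator.act]]
    simp only [neg_eq_zero]
    congr 1
    exact Finset.prod_congr rfl fun p hp => by
      rw [show (Generator.neg i h).act w p = w p by
        simp [Generator.act, Finset.ne_of_mem_erase hp]]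
  | tau i j h h' =>
    have hβ0 : β = 0 := by
      rcases hβ with rfl | h0
      · exact hg.elim
      · exact h0
    have hb : (Generator.tau i j h h').bTerm β = (0 : Laurent n R) := by simp [bTerm, coef]
    rw [hb, zero_mul, add_zero, one_mul, one_mul, hβ0, seriesCT_zero, seriesCT_zero, CT_mon, CT_mon]
    congr 1
    refine propext ⟨fun h0 => ?_, fun h0 => by rw [h0, act_eq, map_zero, zero_smul, sub_zero]⟩
    have := congrArg (Generator.tau i j h h').act h0
    rwa [act_act, act_eq _ 0, map_zero, zero_smul, sub_zero] at this

/-! ### The weights of the scalar products -/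

namespace RootKind

/-- The factor of the root `e_p + e_q`. -/
def sumFactor : RootKind → Fin n → Fin n → Laurent n R
  | .A, _, _ => 1
  | _, p, q => 1 - x p * x q

/-- The factors of the roots `2 e_p`. -/
def longFactor : RootKind → Laurent n R
  | .BC => ∏ p, (1 - x p * x p)
  | _ => 1

/-- The product of `1 - x^α` over the positive roots `α`. -/
def weight (κ : RootKind) : Laurent n R :=
  κ.longFactor * ∏ p, ∏ q ∈ Finset.Ioi p, (1 - x p * xInv q) * κ.sumFactor p q

theorem sub_s_x {i j : Fin n} (h : (i : ℕ) + 1 = j) (p : Fin n) :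
    (Generator.s i j h).sub (x p : Laurent n R) = x (Equiv.swap i j p) := by
  rw [x, sub_mon, x]
  congr 1
  ext q
  simp only [act_s_apply, Pi.single_apply, Equiv.swap_apply_eq_iff]

theorem sub_s_xInv {i j : Fin n} (h : (i : ℕ) + 1 = j) (p : Fin n) :
    (Generator.s i j h).sub (xInv p : Laurent n R) = xInv (Equiv.swap i j p) := by
  rw [xInv, sub_mon, xInv]
  congr 1
  ext q
  simp only [act_s_apply, Pi.single_apply, Equiv.swap_apply_eq_iff]

theorem sub_neg_x_of_ne {i : Fin n} (h : (i : ℕ) + 1 = n) {p : Fin n} (hp : p ≠ i) :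
    (Generator.neg i h).sub (x p : Laurent n R) = x p := by
  rw [x, sub_mon, act_of_ht_eq_zero (by simp [hp.symm])]

theorem sub_neg_xInv_of_ne {i : Fin n} (h : (i : ℕ) + 1 = n) {p : Fin n} (hp : p ≠ i) :
    (Generator.neg i h).sub (xInv p : Laurent n R) = xInv p := by
  rw [xInv, sub_mon, act_of_ht_eq_zero (by simp [hp.symm])]

theorem sub_neg_x {i : Fin n} (h : (i : ℕ) + 1 = n) :
    (Generator.neg i h).sub (x i : Laurent n R) = xInv i := by
  rw [x, sub_mon, xInv]
  congr 1
  ext q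
  rcases eq_or_ne q i with rfl | hq <;> simp [Generator.act, *]

theorem sub_neg_xInv {i : Fin n} (h : (i : ℕ) + 1 = n) :
    (Generator.neg i h).sub (xInv i : Laurent n R) = x i := by
  rw [← sub_neg_x h, Generator.sub_sub]

theorem weight_factor_s (κ : RootKind) {i j : Fin n} (h : (i : ℕ) + 1 = j) :
    ∃ S : Laurent n R, κ.weight = (1 - x i * xInv j) * S ∧ (Generator.s i j h).sub S = S := by
  refine ⟨κ.longFactor * (κ.sumFactor i j *
    ∏ p ∈ pairsExcept i j, (1 - x p.1 * xInv p.2) * κ.sumFactor p.1 p.2), ?_, ?_⟩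
  · rw [weight, prod_pairs_eq_mul _ h]; ring
  · have h1 (p q : Fin n) : (Generator.s i j h).sub (κ.sumFactor p q : Laurent n R) =
        κ.sumFactor (Equiv.swap i j p) (Equiv.swap i j q) := by
      cases κ <;> simp [sumFactor, sub_s_x]
    have h2 : (Generator.s i j h).sub (κ.longFactor : Laurent n R) = κ.longFactor := by
      cases κ with
      | BC =>
        simp only [longFactor, map_prod, map_sub, map_mul, map_one, sub_s_x]
        exact Equiv.prod_comp (Equiv.swap i j) fun p => (1 - x p * x p : Laurent n R)
      | _ => simp [longFactor]
    have h3 : (κ.sumFactor j i : Laurent n R) = κ.sumFactor i j := by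
      cases κ <;> simp [sumFactor, mul_comm]
    simp only [map_mul, map_prod, map_sub, map_one, sub_s_x, sub_s_xInv, h1, h2,
      Equiv.swap_apply_left, Equiv.swap_apply_right, h3]
    congr 2
    exact prod_pairsExcept_swap (fun p q => (1 - x p * xInv q : Laurent n R) * κ.sumFactor p q) h

theorem sub_neg_prod_pairs {i : Fin n} (h : (i : ℕ) + 1 = n) :
    (Generator.neg i h).sub (∏ p, ∏ q ∈ Finset.Ioi p, (1 - x p * xInv q) * (1 - x p * x q) :
      Laurent n R) = ∏ p, ∏ q ∈ Finset.Ioi p, (1 - x p * xInv q) * (1 - x p * x q) := by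
  simp only [map_prod]
  refine Finset.prod_congr rfl fun p _ => Finset.prod_congr rfl fun q hq => ?_
  rw [Finset.mem_Ioi, Fin.lt_def] at hq
  have hp : p ≠ i := by rintro rfl; omega
  rcases eq_or_ne q i with rfl | hqi
  · simp only [map_mul, map_sub, map_one, sub_neg_x_of_ne h hp, sub_neg_x, sub_neg_xInv]
    ring
  · simp only [map_mul, map_sub, map_one, sub_neg_x_of_ne h hp, sub_neg_x_of_ne h hqi,
      sub_neg_xInv_of_ne h hqi]

/-- Each reflection permutes the positive roots other than its own. -/
theorem weight_factor {κ : RootKind} {g : Generator n} (hg : κ.Uses g) :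
    ∃ S : Laurent n R, κ.weight = (1 - mon g.root) * S ∧ g.sub S = S := by
  cases g with
  | s i j h =>
    rw [show (mon (Generator.s i j h).root : Laurent n R) = x i * xInv j by
      rw [x, xInv, ← mon_add, root, Pi.single_neg, sub_eq_add_neg]]
    exact κ.weight_factor_s h
  | neg i h =>
    cases κ with
    | A => exact hg.elim
    | D => exact hg.elim
    | BC =>
      rw [show (mon (Generator.neg i h).root : Laurent n R) = x i * x i by
        rw [x, ← mon_add, root, ← Pi.single_add]; rfl]
      refine ⟨(∏ p ∈ Finset.univ.erase i, (1 - x p * x p)) *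
        ∏ p, ∏ q ∈ Finset.Ioi p, (1 - x p * xInv q) * (1 - x p * x q), ?_, ?_⟩
      · rw [weight, longFactor, ← Finset.mul_prod_erase _ _ (Finset.mem_univ i)]
        simp only [sumFactor]
        ring
      · rw [map_mul, sub_neg_prod_pairs, map_prod]
        congr 1
        refine Finset.prod_congr rfl fun p hp => ?_
        simp only [map_mul, map_sub, map_one, sub_neg_x_of_ne h (Finset.ne_of_mem_erase hp)]
  | tau i j h h' =>
    cases κ with
    | A => exact hg.elim
    | BC => exact hg.elim
    | D =>
      have hij : (i : ℕ) + 1 = j := by omega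
      rw [show (mon (Generator.tau i j h h').root : Laurent n R) = x i * x j by
        rw [x, x, ← mon_add, root]]
      obtain ⟨S, hS, hS'⟩ := RootKind.D.weight_factor_s (R := R) hij
      have hinv : (Generator.neg j h').sub (RootKind.D.weight : Laurent n R) =
          RootKind.D.weight := by
        simp only [weight, longFactor, sumFactor, one_mul]
        exact sub_neg_prod_pairs h'
      refine ⟨(Generator.neg j h').sub S, ?_, ?_⟩
      · conv_lhs => rw [← hinv, hS]
        simp only [map_mul, map_sub, map_one, sub_neg_xInv,
          sub_neg_x_of_ne h' (ne_of_succ_eq hij)]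
      · have htau (f : Laurent n R) : (Generator.tau i j h h').sub f = (Generator.neg j h').sub
            ((Generator.s i j hij).sub ((Generator.neg j h').sub f)) := by
          refine linearMap_ext_mon (φ := (Generator.tau i j h h').sub.toLinearMap)
            (ψ := (Generator.neg j h').sub.toLinearMap ∘ₗ
              (Generator.s i j hij).sub.toLinearMap ∘ₗ (Generator.neg j h').sub.toLinearMap)
            (fun w => ?_) f
          simp [act_tau_eq h h' hij]
        rw [htau, Generator.sub_sub, hS']

/-- The scalar product as a linear form in the product of its arguments, without the sign
`(-1)^n` of the types `B`, `C`, `BC`. -/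
def form (κ : RootKind) (β : R) : Laurent n R →ₗ[R] R :=
  seriesCT β ∘ₗ LinearMap.mulRight R κ.weight

theorem form_apply (κ : RootKind) (β : R) (f : Laurent n R) :
    κ.form β f = seriesCT β (f * κ.weight) := rfl

/-- The operators `π_g` are self-adjoint. -/
theorem form_demazure {κ : RootKind} {β : R} (hβ : κ = .BC ∨ β = 0) {g : Generator n}
    (hg : κ.Uses g) (f h : Laurent n R) :
    κ.form β (demazure β g f * h) = κ.form β (f * demazure β g h) := by
  obtain ⟨S, hS, hS'⟩ := weight_factor (R := R) hg
  have hinv : (mon g.root * mon (-g.root) : Laurent n R) = 1 := mon_mul_mon_neg _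
  have key := seriesCT_sub hβ hg (S * (f * g.sub h))
  rw [map_mul g.sub, map_mul g.sub, hS', Generator.sub_sub] at key
  rw [← sub_eq_zero, ← map_sub, form_apply, hS]
  have e : (demazure β g f * h - f * demazure β g h) * ((1 - mon g.root) * S) =
      (1 + g.bTerm β * mon g.root) * (S * (g.sub f * h)) -
        (1 + g.bTerm β * mon g.root) * (S * (f * g.sub h)) := by
    linear_combination (-mon g.root * S * h) * demazure_mul β g f
      + mon g.root * S * f * demazure_mul β g h
      + (S * f * demazure β g h - S * h * demazure β g f
        - S * f * g.sub h + S * h * g.sub f) * hinv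
  rw [e, map_sub, key, sub_self]

/-! ### Positivity -/

theorem Dominant.dot_sub {κ : RootKind} {lam : Fin n → ℤ} (hl : κ.Dominant lam) {p q : Fin n}
    (hpq : p < q) : 0 ≤ lam p - lam q := by
  have := hl.antitone hpq.le
  omega

/-- The exponents on the strictly positive side of `ρ^C` and on the nonnegative side of `lam`. All
positive roots belong to it if `lam` is dominant; the condition on `ρ^C` serves to exclude zero. -/
def posCone (lam : Fin n → ℤ) : Set (Fin n → ℤ) := {γ | 0 ≤ γ ⬝ᵥ lam ∧ 0 < γ ⬝ᵥ rhoC}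

/-- The span of the monomials with exponents in `posCone lam`. -/
def posSpan (R : Type*) [CommRing R] (lam : Fin n → ℤ) : Submodule R (Laurent n R) :=
  Submodule.span R (mon '' posCone lam)

theorem mon_mem_posSpan {lam γ : Fin n → ℤ} (h : γ ∈ posCone lam) : mon γ ∈ posSpan R lam :=
  Submodule.subset_span ⟨γ, h, rfl⟩

theorem mul_mem_posSpan {lam : Fin n → ℤ} {f g : Laurent n R} (hf : f ∈ posSpan R lam)
    (hg : g ∈ posSpan R lam) : f * g ∈ posSpan R lam := by
  have h := Submodule.mul_mem_mul hf hg
  rw [posSpan, Submodule.span_mul_span] at h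
  refine Submodule.span_mono ?_ h
  rintro _ ⟨_, ⟨a, ha, rfl⟩, _, ⟨b, hb, rfl⟩, rfl⟩
  refine ⟨a + b, ⟨?_, ?_⟩, mon_add a b⟩
  · rw [add_dotProduct]; exact _root_.add_nonneg ha.1 hb.1
  · rw [add_dotProduct]; exact add_pos ha.2 hb.2

theorem mul_sub_one_mem_posSpan {lam : Fin n → ℤ} {f g : Laurent n R}
    (hf : f - 1 ∈ posSpan R lam) (hg : g - 1 ∈ posSpan R lam) : f * g - 1 ∈ posSpan R lam := by
  rw [show f * g - 1 = (f - 1) * (g - 1) + (f - 1) + (g - 1) by ring]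
  exact add_mem (add_mem (mul_mem_posSpan hf hg) hf) hg

theorem prod_sub_one_mem_posSpan {ι : Type*} {lam : Fin n → ℤ} (s : Finset ι)
    {f : ι → Laurent n R} (h : ∀ i ∈ s, f i - 1 ∈ posSpan R lam) :
    ∏ i ∈ s, f i - 1 ∈ posSpan R lam :=
  Finset.prod_induction f (fun F => F - 1 ∈ posSpan R lam)
    (fun _ _ => mul_sub_one_mem_posSpan) (by simp) h

theorem one_sub_mon_mem {lam γ : Fin n → ℤ} (h : γ ∈ posCone lam) :
    (1 - mon γ) - 1 ∈ posSpan R lam := by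
  rw [sub_sub_cancel_left]
  exact neg_mem (mon_mem_posSpan h)

theorem rhoC_pos (p : Fin n) : 0 < rhoC p := by rw [rhoC]; omega

/-- The constant term of the weight is `1`, and all its other exponents lie in the cone. -/
theorem weight_sub_one_mem {κ : RootKind} {lam : Fin n → ℤ} (hl : κ.Dominant lam) :
    (κ.weight : Laurent n R) - 1 ∈ posSpan R lam := by
  refine mul_sub_one_mem_posSpan ?_ (prod_sub_one_mem_posSpan _ fun p _ =>
    prod_sub_one_mem_posSpan _ fun q hq => mul_sub_one_mem_posSpan ?_ ?_)
  · cases κ with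
    | BC =>
      refine prod_sub_one_mem_posSpan _ fun p _ => ?_
      rw [x, ← mon_add]
      refine one_sub_mon_mem ⟨?_, ?_⟩
      · have := hl.nonneg p
        rw [add_dotProduct, single_dotProduct]; omega
      · have := rhoC_pos p
        rw [add_dotProduct, single_dotProduct]; omega
    | _ => simp [longFactor]
  · rw [Finset.mem_Ioi] at hq
    rw [x, xInv, ← mon_add]
    refine one_sub_mon_mem ⟨?_, ?_⟩
    · have := hl.dot_sub hq
      rw [add_dotProduct, single_dotProduct, single_dotProduct]; omega
    · rw [Fin.lt_def] at hq
      rw [add_dotProduct, single_dotProduct, single_dotProduct, rhoC, rhoC]; omega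
  · rw [Finset.mem_Ioi] at hq
    have h1 := rhoC_pos p
    have h2 := rhoC_pos q
    cases κ with
    | A => simp [sumFactor]
    | BC =>
      rw [sumFactor, x, x, ← mon_add]
      · refine one_sub_mon_mem ⟨?_, ?_⟩
        · have := hl.nonneg p
          have := hl.nonneg q
          rw [add_dotProduct, single_dotProduct, single_dotProduct]; omega
        · rw [add_dotProduct, single_dotProduct, single_dotProduct]; omega
      · exact RootKind.noConfusion
    | D =>
      rw [sumFactor, x, x, ← mon_add]
      · refine one_sub_mon_mem ⟨?_, ?_⟩
        · have := hl.add_nonneg hq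
          rw [add_dotProduct, single_dotProduct, single_dotProduct]; omega
        · rw [add_dotProduct, single_dotProduct, single_dotProduct]; omega
      · exact RootKind.noConfusion

/-- The exponents `e` on which the twisted constant term does not vanish are nonpositive, and zero
in the absence of a twist. -/
theorem of_seriesCT_mon_ne_zero {κ : RootKind} {β : R} (hβ : κ = .BC ∨ β = 0)
    {lam : Fin n → ℤ} (hl : κ.Dominant lam) {e : Fin n → ℤ} (he : seriesCT β (mon e) ≠ 0) :
    e ⬝ᵥ lam ≤ 0 ∧ e ⬝ᵥ rhoC ≤ 0 := by
  have hle (p : Fin n) : e p ≤ 0 := by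
    by_contra hlt
    refine he ?_
    rw [seriesCT_mon]
    exact Finset.prod_eq_zero (Finset.mem_univ p) (if_neg (by omega))
  refine ⟨?_, Finset.sum_nonpos fun p _ => mul_nonpos_of_nonpos_of_nonneg (hle p)
    (rhoC_pos p).le⟩
  rcases hβ with rfl | rfl
  · exact Finset.sum_nonpos fun p _ => mul_nonpos_of_nonpos_of_nonneg (hle p) (hl.nonneg p)
  · rw [seriesCT_zero, CT_mon] at he
    rw [show e = 0 by by_contra h0; exact he (if_neg h0), zero_dotProduct]

/-- If `x^w` and `x^lam` are not orthogonal, then `w + lam` lies on the nonpositive side of `lam`,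
whence `|w| ≥ |lam|`, with equality only for `w = -lam`. -/
theorem form_mon_add {κ : RootKind} {β : R} (hβ : κ = .BC ∨ β = 0) {lam w : Fin n → ℤ}
    (hl : κ.Dominant lam) (hw : normSq w ≤ normSq lam) :
    κ.form β (mon (w + lam)) = if w = -lam then 1 else 0 := by
  have hnorm (h : (w + lam) ⬝ᵥ lam ≤ 0) : w + lam = 0 := by
    refine normSq_eq_zero.mp (le_antisymm ?_ (normSq_nonneg _))
    simp only [normSq, add_dotProduct, dotProduct_add, dotProduct_comm lam w] at hw h ⊢
    linarith
  have hcone (γ : Fin n → ℤ) (hγ : γ ∈ posCone lam) :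
      seriesCT β (mon (w + lam) * mon γ) = 0 := by
    by_contra hne
    rw [← mon_add] at hne
    obtain ⟨h1, h2⟩ := of_seriesCT_mon_ne_zero hβ hl hne
    rw [add_dotProduct] at h1 h2
    have h3 := hγ.1
    have h4 := hγ.2
    rw [hnorm (by linarith), zero_dotProduct] at h2
    linarith
  have hker : posSpan R lam ≤ LinearMap.ker (seriesCT β ∘ₗ LinearMap.mulLeft R (mon (w + lam))) :=
    Submodule.span_le.mpr (by rintro _ ⟨γ, hγ, rfl⟩; exact hcone γ hγ)
  have h1 := hker (weight_sub_one_mem hl)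
  rw [LinearMap.mem_ker, LinearMap.comp_apply, LinearMap.mulLeft_apply, mul_sub, mul_one, map_sub,
    sub_eq_zero] at h1
  rw [form_apply, h1]
  split_ifs with h
  · rw [h, neg_add_cancel, seriesCT_mon]
    exact Finset.prod_eq_one fun p _ => by simp [invCoeff]
  · by_contra hne
    exact h (eq_neg_of_add_eq_zero_left (hnorm (of_seriesCT_mon_ne_zero hβ hl hne).1))

/-- Pairing with `x^lam` for dominant `lam` extracts one coefficient of `f`. -/
theorem form_mul_mon {κ : RootKind} {β : R} (hβ : κ = .BC ∨ β = 0) {lam : Fin n → ℤ}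
    (hl : κ.Dominant lam) {f : Laurent n R} (hf : ∀ w, f.coeff w ≠ 0 → normSq w ≤ normSq lam) :
    κ.form β (f * mon lam) = f.coeff (-lam) := by
  classical
  have := eq_extend (κ.form β ∘ₗ LinearMap.mulRight R (mon lam)) f
  rw [LinearMap.comp_apply, LinearMap.mulRight_apply] at this
  rw [this, Finsupp.sum, Finset.sum_congr rfl (g := fun w => if w = -lam then f.coeff w else 0)]
  · rw [Finset.sum_ite_eq']
    split_ifs with hm
    · rfl
    · exact (Finsupp.notMem_support_iff.mp hm).symm
  · intro w hw
    rw [LinearMap.comp_apply, LinearMap.mulRight_apply, ← mon_add,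
      form_mon_add hβ hl (hf w (Finsupp.mem_support_iff.mp hw))]
    simp

end RootKind

/-! ### Orthogonality -/

/-- `K_v` is orthogonal to all Laurent polynomials supported in a ball of radius less than `|v|`:
the operators `π_g` preserve the ball, so that they can be moved to the other side until
`K_v` becomes a monomial. -/
theorem GenKey.form_mul_eq_zero {κ : RootKind} {β : R} (hβ : κ = .BC ∨ β = 0) {v : Fin n → ℤ}
    {f : Laurent n R} (hf : GenKey κ (fun g => demazure β g) v f) {N : ℤ} (hN : N < normSq v)
    {h : Laurent n R} (hh : ∀ w, h.coeff w ≠ 0 → normSq w ≤ N) : κ.form β (f * h) = 0 := by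
  induction hf generalizing h with
  | base v hv =>
    rw [mul_comm, RootKind.form_mul_mon hβ hv fun w hw => (hh w hw).trans hN.le]
    by_contra hne
    have := hh _ hne
    rw [normSq_neg] at this
    omega
  | step g v f hg hv hf ih =>
    rw [normSq_act] at hN
    rw [RootKind.form_demazure hβ hg]
    exact ih hN (normSq_le_of_coeff_demazure_ne_zero β g hh)

/-- The orthogonality `Θ(K_v K̂_u) = δ_{-v,u}`, by induction along the recursion of `K̂_u`. -/
theorem GenKey.form_mul {κ : RootKind} {β : R} (hβ : κ = .BC ∨ β = 0) {u v : Fin n → ℤ}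
    {f h : Laurent n R} (hf : GenKey κ (fun g => demazure β g) v f)
    (hh : GenKey κ (fun g p => demazure β g p - p) u h) :
    κ.form β (f * h) = if -v = u then 1 else 0 := by
  induction hh generalizing v f with
  | base lam hl =>
    rcases lt_or_ge (normSq lam) (normSq v) with hlt | hle
    · rw [hf.form_mul_eq_zero hβ hlt, if_neg]
      · rintro rfl
        rw [normSq_neg] at hlt
        exact lt_irrefl _ hlt
      · intro w hw
        rw [coeff_mon] at hw
        split_ifs at hw with h0
        · rw [h0]
        · exact absurd rfl hw
    · rw [RootKind.form_mul_mon hβ hl fun w hw => (hf.coeff_eq.1 w hw).trans hle]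
      rcases hle.lt_or_eq with hlt | heq
      · rw [if_neg]
        · by_contra hne
          have := hf.coeff_eq.1 _ hne
          rw [normSq_neg] at this
          omega
        · rintro rfl
          rw [normSq_neg] at hlt
          exact lt_irrefl _ hlt
      · rw [hf.coeff_eq.2 _ (by rw [normSq_neg, heq])
          (by rw [neg_neg, hl.length_eq_zero]; exact Nat.zero_le _)]
        simp only [neg_eq_iff_eq_neg, eq_comm (a := v)]
  | step g u h hg hu hh ih =>
    rw [mul_sub, map_sub, ← RootKind.form_demazure hβ hg]
    -- `K_v π_g` is `K_v` or the key polynomial of the reflected index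
    rcases le_or_gt (g.ht v) 0 with h0 | h0
    · rw [hf.demazure_eq_self hg h0, sub_self, if_neg]
      intro h1
      have := congrArg g.ht h1
      rw [map_neg, ht_act] at this
      omega
    · rw [ih (.step g v f hg h0 hf), ih hf, if_neg (c := -v = u), sub_zero]
      · congr 1
        refine propext ⟨fun h1 => ?_, fun h1 => ?_⟩
        · rw [← h1, g.act_neg, g.act_act]
        · rw [← g.act_neg, h1, g.act_act]
      · rintro rfl
        rw [map_neg] at hu
        omega

end

open Generator

section

variable {R : Type*}

/-! ### Length and indices in type `D` -/

theorem act_neg_last {i : Fin n} (h : (i : ℕ) + 1 = n) (v : Fin n → ℤ) :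
    (Generator.neg i h).act v i = -v i := by simp [Generator.act]

theorem act_neg_of_ne {i : Fin n} (h : (i : ℕ) + 1 = n) (v : Fin n → ℤ) {p : Fin n}
    (hp : p ≠ i) : (Generator.neg i h).act v p = v p := by simp [Generator.act, hp]

/-- The indices of type `D` are the vectors whose product of components is nonnegative, a condition
that is visibly invariant under the Weyl group. -/
theorem isIndexD_iff (v : Fin n → ℤ) : IsIndexD v ↔ 0 ≤ ∏ i, v i := by
  have h1 : ∏ i, v i = (-1) ^ (Finset.univ.filter fun i => v i < 0).card * ∏ i, |v i| := by
    rw [Finset.prod_congr rfl fun i _ =>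
      show v i = (if v i < 0 then -1 else 1) * |v i| by
        split_ifs with h
        · rw [abs_of_neg h]; ring
        · rw [abs_of_nonneg (not_lt.mp h), one_mul], Finset.prod_mul_distrib, Finset.prod_ite]
    simp only [Finset.prod_const, one_pow, mul_one]
  by_cases h0 : ∃ i, v i = 0
  · obtain ⟨i, hi⟩ := h0
    rw [Finset.prod_eq_zero (Finset.mem_univ i) hi]
    exact ⟨fun _ => le_rfl, fun _ => .inl ⟨i, hi⟩⟩
  · have hpos : 0 < ∏ i, |v i| :=
      Finset.prod_pos fun i _ => abs_pos.mpr fun hi => h0 ⟨i, hi⟩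
    rw [IsIndexD, or_iff_right h0, h1]
    rcases Nat.even_or_odd (Finset.univ.filter fun i => v i < 0).card with he | ho
    · rw [he.neg_one_pow, one_mul]
      exact ⟨fun _ => hpos.le, fun _ => he⟩
    · rw [ho.neg_one_pow]
      refine ⟨fun he => absurd he (Nat.not_even_iff_odd.mpr ho), fun h => ?_⟩
      omega

theorem prod_act_neg {i : Fin n} (h : (i : ℕ) + 1 = n) (v : Fin n → ℤ) :
    ∏ p, (Generator.neg i h).act v p = -∏ p, v p := by
  rw [← Finset.mul_prod_erase _ _ (Finset.mem_univ i), ← Finset.mul_prod_erase _ v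
    (Finset.mem_univ i), act_neg_last, Finset.prod_congr rfl fun p hp =>
    act_neg_of_ne h v (Finset.ne_of_mem_erase hp)]
  ring

theorem IsIndexD.act {v : Fin n → ℤ} (h : IsIndexD v) {g : Generator n}
    (hg : RootKind.D.Uses g) : IsIndexD (g.act v) := by
  rw [isIndexD_iff] at h ⊢
  have hs (i j : Fin n) (hij) (w : Fin n → ℤ) : ∏ p, (Generator.s i j hij).act w p = ∏ p, w p := by
    simp only [RootKind.act_s_apply]
    exact Equiv.prod_comp _ w
  cases g with
  | s i j hij => rwa [hs]
  | neg i hi => exact hg.elim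
  | tau i j hi hj =>
    rwa [RootKind.act_tau_eq hi hj (by omega), prod_act_neg, hs, prod_act_neg, neg_neg]

theorem RootKind.Dominant.nonneg_of_isIndexD {v : Fin n → ℤ} (h : RootKind.D.Dominant v)
    (hv : IsIndexD v) (i : Fin n) : 0 ≤ v i := by
  have hlt : n - 1 < n := by have := i.2; omega
  set l : Fin n := ⟨n - 1, hlt⟩ with hl
  have hle (p : Fin n) : p ≤ l := Fin.le_def.mpr (by simp only [hl]; omega)
  by_contra hi
  have hneg : v l < 0 := (h.antitone (hle i)).trans_lt (not_le.mp hi)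
  -- a negative last component forces all the others to be positive
  have hpos (p : Fin n) (hp : p ≠ l) : 0 < v p := by
    have := h.add_nonneg (lt_of_le_of_ne (hle p) hp)
    omega
  rw [isIndexD_iff, ← Finset.mul_prod_erase _ _ (Finset.mem_univ l)] at hv
  have : 0 < ∏ p ∈ Finset.univ.erase l, v p :=
    Finset.prod_pos fun p hp => hpos p (Finset.ne_of_mem_erase hp)
  nlinarith

theorem RootKind.dominant_of_antitone_of_nonneg (κ : RootKind) {v : Fin n → ℤ} (h : Antitone v)
    (h0 : ∀ i, 0 ≤ v i) : κ.Dominant v := by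
  intro g _
  cases g with
  | s i j hij =>
    have := h (show i ≤ j from Fin.le_def.mpr (by omega))
    rw [ht_s]; omega
  | neg i hi => exact h0 i
  | tau i j hi hj => exact _root_.add_nonneg (h0 i) (h0 j)

theorem exists_abs_act (g : Generator n) (v : Fin n → ℤ) :
    ∃ τ : Equiv.Perm (Fin n), ∀ p, |g.act v p| = |v (τ p)| := by
  have hneg (i : Fin n) (h) (w : Fin n → ℤ) (p) : |(Generator.neg i h).act w p| = |w p| := by
    rcases eq_or_ne p i with rfl | hp
    · rw [act_neg_last, abs_neg]
    · rw [act_neg_of_ne h w hp]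
  cases g with
  | s i j h => exact ⟨Equiv.swap i j, fun p => by rw [RootKind.act_s_apply]⟩
  | neg i h => exact ⟨1, hneg i h v⟩
  | tau i j h h' =>
    refine ⟨Equiv.swap i j, fun p => ?_⟩
    rw [RootKind.act_tau_eq h h' (by omega), hneg, RootKind.act_s_apply, hneg]

theorem RootKind.exists_descent {κ : RootKind} {v : Fin n → ℤ} (h : ¬κ.Dominant v) :
    ∃ g : Generator n, κ.Uses g ∧ 0 < g.ht (g.act v) ∧
      κ.length v = κ.length (g.act v) + 1 := by
  simp only [RootKind.Dominant, not_forall, not_le] at h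
  obtain ⟨g, hg, hv⟩ := h
  have h0 : 0 < g.ht (g.act v) := by rw [ht_act]; omega
  exact ⟨g, hg, h0, by rw [← RootKind.length_act hg h0, g.act_act]⟩

theorem RootKind.length_le_length_act_add_one {κ : RootKind} {g : Generator n} (hg : κ.Uses g)
    (v : Fin n → ℤ) : κ.length v ≤ κ.length (g.act v) + 1 := by
  rcases lt_trichotomy (g.ht v) 0 with h | h | h
  · rw [← RootKind.length_act hg (by rw [ht_act]; omega), g.act_act]
  · rw [act_of_ht_eq_zero h]; omega
  · rw [RootKind.length_act hg h]; omega

theorem RootKind.length_le_length_foldl {κ : RootKind} (l : List (Generator n))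
    (hl : ∀ g ∈ l, κ.Uses g) (v : Fin n → ℤ) :
    κ.length v ≤ κ.length (l.foldl (fun w g => g.act w) v) + l.length := by
  induction l generalizing v with
  | nil => simp
  | cons g l ih =>
    have h1 := κ.length_le_length_act_add_one (hl g (by simp)) v
    have h2 := ih (fun g hg => hl g (by simp [hg])) (g.act v)
    simp only [List.foldl_cons, List.length_cons]
    omega

/-- A dominant vector with the index condition is a partition, so that descending as long as
possible reaches the decreasing reordering of the `|v_i|`. -/
theorem exists_word_of_isIndexD {v : Fin n → ℤ} (hv : IsIndexD v) :
    ∃ l : List (Generator n), l.length = RootKind.D.length v ∧ (∀ g ∈ l, RootKind.D.Uses g) ∧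
      IsDecreasingReordering v (l.foldl (fun w g => g.act w) v) := by
  induction hN : RootKind.D.length v generalizing v with
  | zero =>
    refine ⟨[], rfl, by simp, ?_⟩
    have hd : RootKind.D.Dominant v := by
      by_contra h
      obtain ⟨g, -, -, h⟩ := RootKind.exists_descent h
      omega
    exact ⟨hd.antitone, 1, fun i => (abs_of_nonneg (hd.nonneg_of_isIndexD hv i)).symm⟩
  | succ N ih =>
    have hd : ¬RootKind.D.Dominant v := fun h => by rw [h.length_eq_zero] at hN; omega
    obtain ⟨g, hg, -, hl⟩ := RootKind.exists_descent hd
    obtain ⟨l, h1, h2, h3, σ, h4⟩ := ih (hv.act hg) (by omega)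
    obtain ⟨τ, hτ⟩ := exists_abs_act g v
    exact ⟨g :: l, by simp [h1], by simpa [hg] using h2, h3, σ.trans τ,
      fun i => (h4 i).trans (hτ _)⟩

/-- The length by words agrees with the number of positive roots that are negative on `v`: a
generator changes this number by at most one, and it is zero on partitions. -/
theorem length_D_eq {v : Fin n → ℤ} (hv : IsIndexD v) :
    (KeyType.D : KeyType R).length v = RootKind.D.length v := by
  have huse (g : Generator n) : (KeyType.D : KeyType R).Uses g ↔ RootKind.D.Uses g := by
    cases g <;> rfl
  have hmem : RootKind.D.length v ∈ {k | ∃ l : List (Generator n), l.length = k ∧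
      (∀ g ∈ l, (KeyType.D : KeyType R).Uses g) ∧
      IsDecreasingReordering v (l.foldl (fun w g => g.act w) v)} := by
    simp only [huse]
    exact exists_word_of_isIndexD hv
  refine le_antisymm (Nat.sInf_le hmem) (le_csInf ⟨_, hmem⟩ ?_)
  rintro k ⟨l, rfl, hl, hanti, σ, hσ⟩
  have h1 := RootKind.length_le_length_foldl (κ := .D) l (fun g hg => (huse g).mp (hl g hg)) v
  rwa [(RootKind.D.dominant_of_antitone_of_nonneg hanti fun i => by
    rw [hσ]; exact abs_nonneg _).length_eq_zero, zero_add] at h1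

/-! ### Comparison with the recursion of the key polynomials -/

namespace KeyType

/-- The root system of a type; the types `B`, `C`, `BC` have the same Weyl group. -/
def kind : KeyType R → RootKind
  | .A => .A
  | .D => .D
  | _ => .BC

theorem uses_iff (t : KeyType R) (g : Generator n) : t.Uses g ↔ t.kind.Uses g := by
  cases t <;> cases g <;> rfl

/-- The indices of the key polynomials. -/
def Index : KeyType R → (Fin n → ℤ) → Prop
  | .A, v => ∀ i, 0 ≤ v i
  | .D, v => IsIndexD v
  | _, _ => True

variable {t : KeyType R} {v : Fin n → ℤ}

theorem Index.act (hv : t.Index v) {g : Generator n} (hg : t.kind.Uses g) :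
    t.Index (g.act v) := by
  cases t with
  | A =>
    intro p
    cases g with
    | s i j h => rw [RootKind.act_s_apply]; exact hv _
    | neg i h => exact hg.elim
    | tau i j h h' => exact hg.elim
  | D => exact IsIndexD.act hv hg
  | _ => trivial

theorem Index.of_nonneg (t : KeyType R) (hv : ∀ i, 0 ≤ v i) : t.Index v := by
  cases t with
  | A => exact hv
  | D => exact (isIndexD_iff v).mpr (Finset.prod_nonneg fun i _ => hv i)
  | _ => trivial

theorem Index.nonneg (hv : t.Index v) (hd : t.kind.Dominant v) (i : Fin n) : 0 ≤ v i := by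
  cases t with
  | A => exact hv i
  | D => exact hd.nonneg_of_isIndexD hv i
  | _ => exact RootKind.Dominant.nonneg hd i

theorem Index.ascends_iff (hv : t.Index v) {g : Generator n} (hg : t.kind.Uses g) :
    t.Ascends v g ↔ 0 < g.ht v := by
  cases g with
  | s i j h => rw [ht_s, sub_pos]; rfl
  | neg i h => rfl
  | tau i j h h' =>
    cases t with
    | D =>
      rw [Ascends, length_D_eq hv, length_D_eq (IsIndexD.act hv hg)]
      refine ⟨fun hlt => ?_, fun h0 => by
        have := RootKind.length_act (κ := .D) hg h0
        omega⟩
      by_contra h0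
      rcases (not_lt.mp h0).lt_or_eq with h1 | h1
      · have := RootKind.length_act (κ := .D) hg (v := (Generator.tau i j h h').act v)
          (by rw [ht_act]; omega)
        rw [act_act] at this
        omega
      · rw [act_of_ht_eq_zero h1] at hlt
        exact lt_irrefl _ hlt
    | _ => exact hg.elim

end KeyType

end

section

variable {R : Type*} [CommRing R]

namespace KeyType

variable {t : KeyType R} {v : Fin n → ℤ}

theorem exists_isKey (op : Generator n → Laurent n R → Laurent n R) (hv : t.Index v) :
    ∃ f, IsKey t op v f := by
  induction hN : t.kind.length v generalizing v with
  | zero =>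
    have hd : t.kind.Dominant v := by
      by_contra h
      obtain ⟨g, -, -, h⟩ := RootKind.exists_descent h
      omega
    exact ⟨_, .dominant v hd.antitone (hv.nonneg hd)⟩
  | succ N ih =>
    have hd : ¬t.kind.Dominant v := fun h => by rw [h.length_eq_zero] at hN; omega
    obtain ⟨g, hg, h0, hl⟩ := RootKind.exists_descent hd
    obtain ⟨f, hf⟩ := ih (hv.act hg) (by omega)
    have := IsKey.step g _ f ((t.uses_iff g).mpr hg) (((hv.act hg).ascends_iff hg).mpr h0) hf
    rw [g.act_act] at this
    exact ⟨_, this⟩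

theorem isKey_key (hv : t.Index v) : IsKey t t.pi v (t.key v) := by
  have h := exists_isKey t.pi hv
  rw [key, dif_pos h]
  exact h.choose_spec

theorem isKey_keyHat (hv : t.Index v) : IsKey t t.piHat v (t.keyHat v) := by
  have h := exists_isKey t.piHat hv
  rw [keyHat, dif_pos h]
  exact h.choose_spec

/-- The index condition is carried along because the ascents of type `D` are only understood under
that condition. -/
theorem index_and_genKey_of_isKey {op op' : Generator n → Laurent n R → Laurent n R}
    (hop : ∀ g f, t.Uses g → op g f = op' g f) {f : Laurent n R} (h : IsKey t op v f) :
    t.Index v ∧ GenKey t.kind op' v f := by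
  induction h with
  | dominant lam h1 h2 =>
    exact ⟨.of_nonneg t h2, .base _ (t.kind.dominant_of_antitone_of_nonneg h1 h2)⟩
  | step g v f hg ha hf ih =>
    have hg' := (t.uses_iff g).mp hg
    refine ⟨ih.1.act hg', ?_⟩
    rw [hop g f hg]
    exact .step g v f hg' ((ih.1.ascends_iff hg').mp ha) ih.2

theorem genKey_key (hv : t.Index v) :
    GenKey t.kind (fun g => demazure t.beta g) v (t.key v) :=
  (index_and_genKey_of_isKey (fun _ f hg => pi_eq_demazure t hg f) (isKey_key hv)).2

theorem genKey_keyHat (hv : t.Index v) :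
    GenKey t.kind (fun g f => demazure t.beta g f - f) v (t.keyHat v) :=
  (index_and_genKey_of_isKey (fun g f hg => by rw [piHat, pi_eq_demazure t hg f])
    (isKey_keyHat hv)).2

theorem form_key_keyHat {u : Fin n → ℤ} (hv : t.Index v) (hu : t.Index u) :
    t.kind.form t.beta (t.key v * t.keyHat u) = if -v = u then 1 else 0 :=
  (genKey_key hv).form_mul (by cases t <;> simp [kind, beta]) (genKey_keyHat hu)

end KeyType

/-! ### Comparison of the scalar products -/

theorem mon_rhoD : (mon rhoD : Laurent n R) = ∏ p, ∏ _q ∈ Finset.Ioi p, x p := by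
  simp only [x, prod_mon]
  congr 1
  ext i
  rw [Finset.sum_apply, Finset.sum_eq_single i]
  · rw [Finset.sum_apply, Finset.sum_const, Fin.card_Ioi, rhoD]
    simp only [Pi.single_eq_same, nsmul_eq_mul]
    omega
  · intro p _ hp
    rw [Finset.sum_apply]
    exact Finset.sum_eq_zero fun q _ => Pi.single_eq_of_ne hp.symm _
  · simp

theorem mon_rhoD_mul_denomD : (mon rhoD * denomD : Laurent n R) = RootKind.D.weight := by
  simp only [mon_rhoD, denomD, RootKind.weight, RootKind.longFactor, RootKind.sumFactor, one_mul,
    ← Finset.prod_mul_distrib]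
  refine Finset.prod_congr rfl fun p _ => Finset.prod_congr rfl fun q _ => ?_
  linear_combination (-(x p - x q) * xInv q) * x_mul_xInv (R := R) p
    + (1 - x p ^ 2) * x_mul_xInv (R := R) q

theorem mon_rhoC : (mon rhoC : Laurent n R) = mon rhoD * ∏ p, x p := by
  simp only [x, prod_mon]
  rw [← mon_add]
  congr 1
  ext i
  rw [Pi.add_apply, Finset.sum_apply, Finset.sum_eq_single i, Pi.single_eq_same, rhoC, rhoD]
  · ring
  · exact fun p _ hp => Pi.single_eq_of_ne hp.symm _
  · simp

theorem weight_BC : (RootKind.BC.weight : Laurent n R) =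
    (∏ p, (1 - x p * x p)) * RootKind.D.weight := by
  simp only [RootKind.weight, RootKind.longFactor, RootKind.sumFactor, one_mul]

theorem prod_neg_eq (f : Fin n → Laurent n R) : ∏ p, -f p = (-1) ^ n * ∏ p, f p := by
  rw [Finset.prod_neg, Finset.card_univ, Fintype.card_fin]

theorem mon_rhoC_mul_denomC :
    (mon rhoC * denomC : Laurent n R) = (-1) ^ n * RootKind.BC.weight := by
  rw [denomC, weight_BC, ← mon_rhoD_mul_denomD, mon_rhoC, ← mul_assoc ((-1) ^ n), ← prod_neg_eq]
  have : (∏ p, x p) * ∏ p, (x p - xInv p) = ∏ p, -(1 - x p * x p : Laurent n R) := by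
    rw [← Finset.prod_mul_distrib]
    exact Finset.prod_congr rfl fun p _ => by linear_combination -x_mul_xInv (R := R) p
  rw [← this]
  ring

theorem map_neg_one_pow_mul (φ : Laurent n R →ₗ[R] R) (f : Laurent n R) (k : ℕ) :
    φ ((-1) ^ k * f) = (-1) ^ k * φ f := by
  rcases neg_one_pow_eq_or (Laurent n R) k with h | h <;>
    rcases Nat.even_or_odd k with hk | hk <;> simp [hk.neg_one_pow]

theorem pairing_BC (β : R) (f g : Laurent n R) :
    (KeyType.BC β).pairing f g = (-1) ^ n * RootKind.BC.form β (f * g) := by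
  rw [KeyType.pairing, ← seriesCT_eq_mulSeries, mon_rhoC_mul_denomC, RootKind.form_apply,
    ← map_neg_one_pow_mul]
  congr 1
  ring

theorem pairing_C (f g : Laurent n R) :
    (KeyType.C : KeyType R).pairing f g = (-1) ^ n * RootKind.BC.form 0 (f * g) := by
  rw [← pairing_BC]
  simp only [KeyType.pairing]
  rw [← seriesCT_eq_mulSeries, seriesCT_zero]

theorem pairing_B (f g : Laurent n R) :
    (KeyType.B : KeyType R).pairing f g = (-1) ^ n * RootKind.BC.form 1 (f * g) := by
  have h1 : (∏ p, (1 - x p * x p) : Laurent n R) = (∏ p, (1 + x p)) * ∏ p, (1 - x p) := by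
    rw [← Finset.prod_mul_distrib]
    exact Finset.prod_congr rfl fun p _ => by ring
  have h2 : (∏ p, (x p - 1) : Laurent n R) = (-1) ^ n * ∏ p, (1 - x p) := by
    rw [← prod_neg_eq]
    exact Finset.prod_congr rfl fun p _ => by ring
  have h3 : f * g * (RootKind.BC.weight) =
      (∏ p, (1 + x p)) * (f * g * ((∏ p, (1 - x p)) * RootKind.D.weight)) := by
    rw [weight_BC, h1]; ring
  rw [RootKind.form_apply, h3, seriesCT_one_mul, ← ctHom_apply, ← map_neg_one_pow_mul,
    KeyType.pairing, weightB, h2, ← mon_rhoD_mul_denomD, ctHom_apply]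
  congr 1
  ring

theorem pairing_D (f g : Laurent n R) :
    (KeyType.D : KeyType R).pairing f g = RootKind.D.form 0 (f * g) := by
  rw [KeyType.pairing, RootKind.form_apply, seriesCT_zero, mon_rhoD_mul_denomD]

theorem pairing_A (f g : Laurent n R) :
    (KeyType.A : KeyType R).pairing f g = RootKind.A.form 0 (f * reverseInvert g) := by
  rw [KeyType.pairing, RootKind.form_apply, seriesCT_zero]
  simp only [RootKind.weight, RootKind.longFactor, RootKind.sumFactor, one_mul, mul_one, weightA]

/-! ### The involution of type `A` -/

/-- The involution `v ↦ [-v_n, …, -v_1]`. -/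
def revNeg : (Fin n → ℤ) →+ (Fin n → ℤ) where
  toFun v i := -v (Fin.rev i)
  map_zero' := by ext; simp
  map_add' v w := by ext; simp; ring

theorem revNeg_apply (v : Fin n → ℤ) (i : Fin n) : revNeg v i = -v (Fin.rev i) := rfl

theorem subst_revNeg (f : Laurent n R) : subst revNeg f = reverseInvert f := rfl

theorem rev_succ {i j : Fin n} (h : (i : ℕ) + 1 = j) :
    (Fin.rev j : ℕ) + 1 = (Fin.rev i : ℕ) := by
  rw [Fin.val_rev, Fin.val_rev]; omega

theorem revNeg_root_s {i j : Fin n} (h : (i : ℕ) + 1 = j) :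
    revNeg (Generator.s i j h).root = (Generator.s (Fin.rev j) (Fin.rev i) (rev_succ h)).root := by
  ext p
  simp only [revNeg_apply, root, Pi.sub_apply, Pi.single_apply, Fin.rev_eq_iff]
  ring

theorem revNeg_act_s {i j : Fin n} (h : (i : ℕ) + 1 = j) (v : Fin n → ℤ) :
    revNeg ((Generator.s i j h).act v) =
      (Generator.s (Fin.rev j) (Fin.rev i) (rev_succ h)).act (revNeg v) := by
  rw [act_eq, act_eq, map_sub, map_zsmul, revNeg_root_s, ht_s, ht_s, revNeg_apply, revNeg_apply,
    Fin.rev_rev, Fin.rev_rev, neg_sub_neg]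

/-- The involution carries `π_i` into `π_{n-i}`. -/
theorem subst_revNeg_demazure {i j : Fin n} (h : (i : ℕ) + 1 = j) (f : Laurent n R) :
    subst revNeg (demazure 0 (Generator.s i j h) f) =
      demazure 0 (Generator.s (Fin.rev j) (Fin.rev i) (rev_succ h)) (subst revNeg f) := by
  have hb (i j : Fin n) (h) : (Generator.s i j h).bTerm (0 : R) = 0 := by simp [bTerm, coef]
  have hsub : subst revNeg ((Generator.s i j h).sub f) =
      (Generator.s (Fin.rev j) (Fin.rev i) (rev_succ h)).sub (subst revNeg f) := by
    refine linearMap_ext_mon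
      (φ := (subst revNeg).toLinearMap ∘ₗ (Generator.s i j h).sub.toLinearMap)
      (ψ := (Generator.s (Fin.rev j) (Fin.rev i) (rev_succ h)).sub.toLinearMap ∘ₗ
        (subst revNeg).toLinearMap) (fun w => ?_) f
    simp [subst_mon, revNeg_act_s]
  have h1 := congrArg (subst revNeg) (demazure_mul 0 (Generator.s i j h) f)
  simp only [map_mul, map_sub, map_add, map_one, subst_mon, map_neg, revNeg_root_s, hsub, hb,
    map_zero] at h1
  refine (mul_cancel_right_mem_nonZeroDivisors (one_sub_root_mem
    (Generator.s (Fin.rev j) (Fin.rev i) (rev_succ h)))).mp ?_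
  rw [h1, demazure_mul, hb]

theorem genKey_reverseInvert {u : Fin n → ℤ} {f : Laurent n R}
    (h : GenKey RootKind.A (fun g f => demazure (0 : R) g f - f) u f) :
    GenKey RootKind.A (fun g f => demazure (0 : R) g f - f) (revNeg u) (subst revNeg f) := by
  induction h with
  | base lam hl =>
    rw [subst_mon]
    refine .base _ fun g hg => ?_
    cases g with
    | s i j h =>
      have := hl (.s (Fin.rev j) (Fin.rev i) (rev_succ h)) trivial
      rw [ht_s] at this ⊢
      rw [revNeg_apply, revNeg_apply]
      omega
    | neg i h => exact hg.elim
    | tau i j h h' => exact hg.elim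
  | step g v f hg hv hf ih =>
    cases g with
    | s i j h =>
      rw [revNeg_act_s, map_sub, subst_revNeg_demazure]
      refine .step _ _ _ trivial ?_ ih
      rw [ht_s] at hv ⊢
      rwa [revNeg_apply, revNeg_apply, Fin.rev_rev, Fin.rev_rev, neg_sub_neg]
    | neg i h => exact hg.elim
    | tau i j h h' => exact hg.elim

theorem form_key_reverseInvert_keyHat {u v : Fin n → ℤ} (hv : ∀ i, 0 ≤ v i)
    (hu : ∀ i, 0 ≤ u i) :
    RootKind.A.form (0 : R) (KeyType.A.key v * reverseInvert (KeyType.A.keyHat u)) =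
      if v = u ∘ Fin.rev then 1 else 0 := by
  have h := (KeyType.genKey_key (t := (KeyType.A : KeyType R)) hv).form_mul (.inr rfl)
    (genKey_reverseInvert (KeyType.genKey_keyHat (t := (KeyType.A : KeyType R)) hu))
  rw [subst_revNeg] at h
  refine h.trans ?_
  congr 1
  refine propext ⟨fun h => ?_, fun h => ?_⟩
  · ext i
    have := congrFun h i
    rw [Pi.neg_apply, revNeg_apply] at this
    simpa using this
  · rw [h]; rfl

end

end

end KeyPoly

theorem theorem15 {R : Type*} [CommRing R] (n : ℕ) :
    (∀ u v : Fin n → ℤ,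
      (KeyPoly.KeyType.B : KeyPoly.KeyType R).pairing
          (KeyPoly.KeyType.B.key v) (KeyPoly.KeyType.B.keyHat u)
        = (-1) ^ n * (if -v = u then 1 else 0)) ∧
    (∀ u v : Fin n → ℤ,
      (KeyPoly.KeyType.C : KeyPoly.KeyType R).pairing
          (KeyPoly.KeyType.C.key v) (KeyPoly.KeyType.C.keyHat u)
        = (-1) ^ n * (if -v = u then 1 else 0)) ∧
    (∀ (β : R) (u v : Fin n → ℤ),
      (KeyPoly.KeyType.BC β).pairing
          ((KeyPoly.KeyType.BC β).key v) ((KeyPoly.KeyType.BC β).keyHat u)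
        = (-1) ^ n * (if -v = u then 1 else 0)) ∧
    (∀ u v : Fin n → ℤ, KeyPoly.IsIndexD u → KeyPoly.IsIndexD v →
      (Odd n → (∃ i, u i = 0) ∨ (∃ i, v i = 0)) →
      (KeyPoly.KeyType.D : KeyPoly.KeyType R).pairing
          (KeyPoly.KeyType.D.key v) (KeyPoly.KeyType.D.keyHat u)
        = if -v = u then 1 else 0) ∧
    (∀ u v : Fin n → ℤ, (∀ i, 0 ≤ u i) → (∀ i, 0 ≤ v i) →
      (KeyPoly.KeyType.A : KeyPoly.KeyType R).pairing
          (KeyPoly.KeyType.A.key v) (KeyPoly.KeyType.A.keyHat u)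
        = if v = u ∘ Fin.rev then 1 else 0) := by
  refine ⟨fun u v => ?_, fun u v => ?_, fun β u v => ?_, fun u v hu hv _ => ?_,
    fun u v hu hv => ?_⟩
  · rw [KeyPoly.pairing_B]
    exact congrArg _ (KeyPoly.KeyType.form_key_keyHat (t := .B) trivial trivial)
  · rw [KeyPoly.pairing_C]
    exact congrArg _ (KeyPoly.KeyType.form_key_keyHat (t := .C) trivial trivial)
  · rw [KeyPoly.pairing_BC]
    exact congrArg _ (KeyPoly.KeyType.form_key_keyHat (t := .BC β) trivial trivial)
  · rw [KeyPoly.pairing_D]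
    exact KeyPoly.KeyType.form_key_keyHat (t := .D) hv hu
  · rw [KeyPoly.pairing_A]
    exact KeyPoly.form_key_reverseInvert_keyHat hv hu
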